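/- A quiver $Q$ is a directed graph with finitely many vertices and arrows (loops, parallel arrows and oriented cycles are allowed). Let $K$ be a field. A representation of $Q$ over $K$ is a finite-dimensional $K$-vector space $V_x$ for each vertex $x$ together with a linear map $V_a\colon V_x\to V_y$ for each arrow $a\colon x\to y$; direct sums and tensor products of representations are formed pointwise. Let $R(Q)$ be the representation ring of $Q$: the free abelian group on isomorphism classes of representations modulo the subgroup generated by all $[V]+[W]-[V\oplus W]$, with product $[V][W]=[V\otimes W]$. Let $R(Q)_{red}$ be the quotient of $R(Q)$ by its ideal of nilpotent elements. The quiver $Q$ is of finite multiplicative type over $K$ if $R(Q)_{red}$ is a finitely generated $\mathbb{Z}$-module. For every field $K$ (finite or infinite) the following hold. (1) The loop quiver $\tilde A_0$ (one vertex, one arrow) is not of finite multiplicative type over $K$. (2) Let $Q$ be the quiver of type $\tilde D_4$ with the "crossing paths" orientation: vertices $1,\dots,5$ and arrows $a\colon 1\to 3$, $b\colon 4\to 3$, $c\colon 3\to 2$, $d\colon 3\to 5$. The underlying graph of $Q$ is a tree, but $Q$ is not of finite multiplicative type over $K$. (3) Let $Q'$ be the quiver of type $\tilde A_3$ with vertices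 $1,2,4,5$ and arrows $1\to 2$, $1\to 5$, $4\to 2$, $4\to 5$. For a representation $V$ of $Q$, let $f^*V$ be the representation of $Q'$ with the spaces $V_1,V_2,V_4,V_5$ and the maps $V_cV_a\colon V_1\to V_2$, $V_dV_a\colon V_1\to V_5$, $V_cV_b\colon V_4\to V_2$, $V_dV_b\colon V_4\to V_5$. For a representation $W$ of $Q'$, let $\mathcal R(W)$ be the image of the composite $E\hookrightarrow W\twoheadrightarrow M$, where $E$ is the largest subrepresentation of $W$ in which the maps of all arrows are surjective and $M$ is the largest quotient of $W$ in which the maps of all arrows are injective; the maps of all arrows of $\mathcal R(W)$ are isomorphisms. For a representation $U$ of $Q'$ in which the maps of all arrows are isomorphisms, let $L(U)$ be the representation of $\tilde A_0$ given by the space $U_1$ with the endomorphism obtained by traversing the cycle $1\to 2\leftarrow 4\to 5\leftarrow 1$ once. Then there is a ring homomorphism $R(Q)\to R(\tilde A_0)$ with $[V]\mapsto[L(\mathcal R(f^*V))]$ for every representation $V$ of $Q$, and its image contains the class of every representation of $\tilde A_0$ whose endomorphism is invertible. (4) If a quiver $P$ is of finite multiplicative type over $K$, then its underlying undirected multigraph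 has no cycles (in particular no loops and no multiple edges); so if $P$ is connected, its underlying graph is a tree. -/

import Mathlib

universe u v w

/-- A representation over the field `K` of the quiver with vertex type `V`: a finite-dimensional
vector space at each vertex and a linear map for each arrow. -/
structure QuiverRep (K : Type u) [Field K] (V : Type v) [Quiver.{w} V] where
  space : V → Type u
  [addCommGroup : ∀ x, AddCommGroup (space x)]
  [module : ∀ x, Module K (space x)]
  [finite : ∀ x, FiniteDimensional K (space x)]
  map : ∀ {x y : V}, (x ⟶ y) → space x →ₗ[K] space y

namespace QuiverRep

attribute [instance] QuiverRep.addCommGroup QuiverRep.module QuiverRep.finite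

section Basic

variable {K : Type u} [Field K] {V : Type v} [Quiver.{w} V]

/-- Two representations are isomorphic if there are linear equivalences at all vertices that
commute with the maps of all arrows. -/
def IsIso (M N : QuiverRep K V) : Prop :=
  ∃ e : ∀ x, M.space x ≃ₗ[K] N.space x,
    ∀ (x y : V) (a : x ⟶ y) (m : M.space x), e y (M.map a m) = N.map a (e x m)

theorem IsIso.refl (M : QuiverRep K V) : IsIso M M :=
  ⟨fun _ => LinearEquiv.refl K _, fun _ _ _ _ => rfl⟩

theorem IsIso.symm {M N : QuiverRep K V} (h : IsIso M N) : IsIso N M := by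
  obtain ⟨e, he⟩ := h
  refine ⟨fun x => (e x).symm, fun x y a m => ?_⟩
  rw [LinearEquiv.symm_apply_eq, he, LinearEquiv.apply_symm_apply]

theorem IsIso.trans {M N P : QuiverRep K V} (h : IsIso M N) (h' : IsIso N P) : IsIso M P := by
  obtain ⟨e, he⟩ := h
  obtain ⟨f, hf⟩ := h'
  exact ⟨fun x => (e x).trans (f x), fun x y a m => by simp [he, hf]⟩

/-- The direct sum of two representations. -/
def directSum (M N : QuiverRep K V) : QuiverRep K V where
  space x := M.space x × N.space x
  map a := (M.map a).prodMap (N.map a)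

/-- The pointwise tensor product of two representations. -/
def tensor (M N : QuiverRep K V) : QuiverRep K V where
  space x := TensorProduct K (M.space x) (N.space x)
  map a := TensorProduct.map (M.map a) (N.map a)

variable (K V) in
/-- The identity representation: `K` at each vertex and the identity at each arrow. -/
def one : QuiverRep K V where
  space _ := K
  map _ := LinearMap.id

theorem IsIso.tensor {M M' N N' : QuiverRep K V} (h : IsIso M M') (h' : IsIso N N') :
    IsIso (M.tensor N) (M'.tensor N') := by
  obtain ⟨e, he⟩ := h
  obtain ⟨f, hf⟩ := h'
  refine ⟨fun x => TensorProduct.congr (e x) (f x), fun x y a m => ?_⟩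
  change TensorProduct K (M.space x) (N.space x) at m
  change TensorProduct.congr (e y) (f y) (TensorProduct.map (M.map a) (N.map a) m) =
    TensorProduct.map (M'.map a) (N'.map a) (TensorProduct.congr (e x) (f x) m)
  induction m using TensorProduct.induction_on with
  | zero => simp
  | tmul p q => simp [he, hf]
  | add p q hp hq => simp only [map_add, hp, hq]

theorem tensor_comm (M N : QuiverRep K V) : IsIso (M.tensor N) (N.tensor M) := by
  refine ⟨fun x => TensorProduct.comm K (M.space x) (N.space x), fun x y a m => ?_⟩
  change TensorProduct K (M.space x) (N.space x) at m
  change TensorProduct.comm K _ _ (TensorProduct.map (M.map a) (N.map a) m) =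
    TensorProduct.map (N.map a) (M.map a) (TensorProduct.comm K _ _ m)
  induction m using TensorProduct.induction_on with
  | zero => simp
  | tmul p q => simp
  | add p q hp hq => simp only [map_add, hp, hq]

theorem tensor_assoc (M N P : QuiverRep K V) :
    IsIso ((M.tensor N).tensor P) (M.tensor (N.tensor P)) := by
  refine ⟨fun x => TensorProduct.assoc K (M.space x) (N.space x) (P.space x),
    fun x y a m => ?_⟩
  change TensorProduct K (TensorProduct K (M.space x) (N.space x)) (P.space x) at m
  change TensorProduct.assoc K _ _ _
      (TensorProduct.map (TensorProduct.map (M.map a) (N.map a)) (P.map a) m) =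
    TensorProduct.map (M.map a) (TensorProduct.map (N.map a) (P.map a))
      (TensorProduct.assoc K _ _ _ m)
  induction m using TensorProduct.induction_on with
  | zero => simp
  | tmul p q =>
    induction p using TensorProduct.induction_on with
    | zero => simp
    | tmul p r => simp
    | add p r hp hr => simp only [TensorProduct.add_tmul, map_add, hp, hr]
  | add p q hp hq => simp only [map_add, hp, hq]

theorem one_tensor (M : QuiverRep K V) : IsIso ((one K V).tensor M) M := by
  refine ⟨fun x => TensorProduct.lid K (M.space x), fun x y a m => ?_⟩
  change TensorProduct K K (M.space x) at m
  change TensorProduct.lid K _ (TensorProduct.map LinearMap.id (M.map a) m) =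
    M.map a (TensorProduct.lid K _ m)
  induction m using TensorProduct.induction_on with
  | zero => simp
  | tmul p q => simp
  | add p q hp hq => simp only [map_add, hp, hq]

theorem tensor_directSum (M N P : QuiverRep K V) :
    IsIso (M.tensor (N.directSum P)) ((M.tensor N).directSum (M.tensor P)) := by
  refine ⟨fun x => TensorProduct.prodRight K K (M.space x) (N.space x) (P.space x),
    fun x y a m => ?_⟩
  change TensorProduct K (M.space x) (N.space x × P.space x) at m
  change TensorProduct.prodRight K K _ _ _
      (TensorProduct.map (M.map a) ((N.map a).prodMap (P.map a)) m) =
    ((TensorProduct.map (M.map a) (N.map a)).prodMap (TensorProduct.map (M.map a) (P.map a)))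
      (TensorProduct.prodRight K K _ _ _ m)
  induction m using TensorProduct.induction_on with
  | zero => rw [map_zero, map_zero, map_zero, map_zero]
  | tmul p q => simp
  | add p q hp hq => simp only [map_add, hp, hq]

end Basic

section RepresentationRing

variable (K : Type u) [Field K] (V : Type v) [Quiver.{w} V]

/-- Isomorphism of representations as an equivalence relation. -/
def isoSetoid : Setoid (QuiverRep K V) where
  r := IsIso
  iseqv := ⟨IsIso.refl, IsIso.symm, IsIso.trans⟩

/-- The type of isomorphism classes of representations. -/
def IsoClass : Type (max (u + 1) v w) := Quotient (isoSetoid K V)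

variable {K V}

/-- The isomorphism class of a representation. -/
def toIsoClass (M : QuiverRep K V) : IsoClass K V := Quotient.mk (isoSetoid K V) M

/-- Isomorphism classes of representations form a commutative monoid under tensor product. -/
instance : CommMonoid (IsoClass K V) where
  mul := Quotient.map₂ tensor fun _ _ h _ _ h' => IsIso.tensor h h'
  one := toIsoClass (one K V)
  mul_assoc := by
    rintro ⟨M⟩ ⟨N⟩ ⟨P⟩
    exact Quotient.sound (tensor_assoc M N P)
  mul_comm := by
    rintro ⟨M⟩ ⟨N⟩
    exact Quotient.sound (tensor_comm M N)
  one_mul := by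
    rintro ⟨M⟩
    exact Quotient.sound (one_tensor M)
  mul_one := by
    rintro ⟨M⟩
    exact Quotient.sound ((tensor_comm M (one K V)).trans (one_tensor M))

theorem toIsoClass_tensor (M N : QuiverRep K V) :
    toIsoClass (M.tensor N) = toIsoClass M * toIsoClass N := rfl

variable (K V)

/-- The subgroup generated by all `[M] + [N] - [M ⊕ N]`, which is an ideal of the free abelian
group on the isomorphism classes with the multiplication induced by the tensor product. -/
def sumIdeal : Ideal (FreeAbelianGroup (IsoClass K V)) where
  __ := AddSubgroup.closure {z | ∃ M N : QuiverRep K V,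
    z = FreeAbelianGroup.of (toIsoClass M) + FreeAbelianGroup.of (toIsoClass N) -
      FreeAbelianGroup.of (toIsoClass (M.directSum N))}
  smul_mem' := by
    intro c z hz
    simp only [AddSubsemigroup.mem_carrier, AddSubmonoid.mem_toSubsemigroup,
      AddSubgroup.mem_toAddSubmonoid, smul_eq_mul] at hz ⊢
    induction c using FreeAbelianGroup.induction_on with
    | zero => rw [zero_mul]; exact zero_mem _
    | of c =>
      obtain ⟨P⟩ := c
      induction hz using AddSubgroup.closure_induction with
      | mem z hz =>
        obtain ⟨M, N, rfl⟩ := hz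
        refine AddSubgroup.subset_closure ⟨P.tensor M, P.tensor N, ?_⟩
        have h : toIsoClass ((P.tensor M).directSum (P.tensor N)) =
            toIsoClass P * toIsoClass (M.directSum N) :=
          (Quotient.sound (tensor_directSum P M N)).symm
        rw [h, toIsoClass_tensor, toIsoClass_tensor, mul_sub, mul_add,
          FreeAbelianGroup.of_mul, FreeAbelianGroup.of_mul, FreeAbelianGroup.of_mul]
        rfl
      | zero => rw [mul_zero]; exact zero_mem _
      | add x y _ _ hx hy => rw [mul_add]; exact add_mem hx hy
      | neg x _ hx => rw [mul_neg]; exact neg_mem hx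
    | neg c hc => rw [neg_mul]; exact neg_mem hc
    | add c d hc hd => rw [add_mul]; exact add_mem hc hd

/-- The representation ring `R(Q)`: the free abelian group on the isomorphism classes of
representations, modulo `[M] + [N] - [M ⊕ N]`, with `[M] * [N] = [M ⊗ N]`. -/
abbrev RepRing : Type (max (u + 1) v w) := FreeAbelianGroup (IsoClass K V) ⧸ sumIdeal K V

variable {K V} in
/-- The class `[M]` in the representation ring. -/
def cls (M : QuiverRep K V) : RepRing K V :=
  Ideal.Quotient.mk (sumIdeal K V) (FreeAbelianGroup.of (toIsoClass M))

/-- The quiver is of finite multiplicative type over `K`: the ring `R(Q)` modulo the ideal of its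
nilpotent elements is a finitely generated `ℤ`-module. -/
def FiniteMultiplicativeType : Prop :=
  Module.Finite ℤ (RepRing K V ⧸ nilradical (RepRing K V))

end RepresentationRing

section GlobalTensorFunctor

variable {K : Type u} [Field K] {V : Type v} [Quiver.{w} V] (M : QuiverRep K V)

/-- A family of subspaces is an epimorphic subrepresentation if each arrow maps the subspace at
its tail onto the subspace at its head. -/
def IsEpiSub (N : ∀ x, Submodule K (M.space x)) : Prop :=
  ∀ (x y : V) (a : x ⟶ y), (N x).map (M.map a) = N y

/-- A family of subspaces is the kernel of a monomorphic quotient if it is a subrepresentation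
such that the maps induced on the quotient spaces are injective, that is, each subspace at the
tail of an arrow is the preimage of the subspace at its head. -/
def IsMonoKer (N : ∀ x, Submodule K (M.space x)) : Prop :=
  ∀ (x y : V) (a : x ⟶ y), (N y).comap (M.map a) = N x

/-- The maximal epimorphic subrepresentation (the sum of all of them). -/
def maxEpi (x : V) : Submodule K (M.space x) :=
  ⨆ N : {N : ∀ x, Submodule K (M.space x) // M.IsEpiSub N}, N.1 x

/-- The kernel of the maximal monomorphic quotient (the intersection of all such kernels). -/
def monoKer (x : V) : Submodule K (M.space x) :=
  ⨅ N : {N : ∀ x, Submodule K (M.space x) // M.IsMonoKer N}, N.1 x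

theorem isEpiSub_maxEpi : M.IsEpiSub M.maxEpi := by
  intro x y a
  simp only [maxEpi, Submodule.map_iSup]
  exact iSup_congr fun N => N.2 x y a

theorem isMonoKer_monoKer : M.IsMonoKer M.monoKer := by
  intro x y a
  simp only [monoKer, Submodule.comap_iInf]
  exact iInf_congr fun N => N.2 x y a

/-- The map of an arrow on the maximal monomorphic quotient. -/
def monoMap {x y : V} (a : x ⟶ y) :
    (M.space x ⧸ M.monoKer x) →ₗ[K] (M.space y ⧸ M.monoKer y) :=
  Submodule.mapQ _ _ (M.map a) (M.isMonoKer_monoKer x y a).ge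

/-- The space at `x` of the image of the composition of the inclusion of the maximal epimorphic
subrepresentation and the projection to the maximal monomorphic quotient. -/
def rankSpace (x : V) : Submodule K (M.space x ⧸ M.monoKer x) :=
  (M.maxEpi x).map (M.monoKer x).mkQ

theorem map_rankSpace {x y : V} (a : x ⟶ y) :
    (M.rankSpace x).map (M.monoMap a) = M.rankSpace y := by
  rw [rankSpace, rankSpace, ← M.isEpiSub_maxEpi x y a, ← Submodule.map_comp,
    ← Submodule.map_comp]
  rfl

/-- The global tensor functor on objects: the image of the composition of the inclusion of the
maximal epimorphic subrepresentation and the projection to the maximal monomorphic quotient. -/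
def globalTensor : QuiverRep K V where
  space x := M.rankSpace x
  map a := (M.monoMap a).restrict fun m hm => by
    rw [← M.map_rankSpace a]
    exact Submodule.mem_map_of_mem hm

theorem globalTensor_bijective {x y : V} (a : x ⟶ y) :
    Function.Bijective (M.globalTensor.map a) := by
  have hinj : Function.Injective (M.monoMap a) := by
    rw [← LinearMap.ker_eq_bot, monoMap, Submodule.ker_mapQ, M.isMonoKer_monoKer x y a,
      Submodule.mkQ_map_self]
  constructor
  · rintro ⟨m, hm⟩ ⟨n, hn⟩ h
    exact Subtype.ext (hinj (congrArg Subtype.val h))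
  · rintro ⟨n, hn⟩
    rw [← M.map_rankSpace a] at hn
    obtain ⟨m, hm, rfl⟩ := hn
    exact ⟨⟨m, hm⟩, rfl⟩

end GlobalTensorFunctor

end QuiverRep

/-- The underlying undirected graph of a quiver, forgetting loops and multiplicities. -/
def QuiverGraph (V : Type v) [Quiver.{w} V] : SimpleGraph V :=
  SimpleGraph.fromRel fun x y => Nonempty (x ⟶ y)

/-- The underlying undirected multigraph of the quiver has no cycles: there is no loop, there are
no two arrows with the same endpoints, and the underlying simple graph is acyclic. -/
def IsForestQuiver (V : Type v) [Quiver.{w} V] : Prop :=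
  (∀ x : V, IsEmpty (x ⟶ x)) ∧ (∀ x y : V, Subsingleton ((x ⟶ y) ⊕ (y ⟶ x))) ∧
    (QuiverGraph V).IsAcyclic

/-- The underlying undirected multigraph of the quiver is connected. -/
def IsConnectedQuiver (V : Type v) [Quiver.{w} V] : Prop := (QuiverGraph V).Connected

/-- The underlying undirected multigraph of the quiver is a tree. -/
def IsTreeQuiver (V : Type v) [Quiver.{w} V] : Prop :=
  IsConnectedQuiver V ∧ IsForestQuiver V

/-- The vertex of the loop quiver. -/
inductive LoopVertex : Type
  | pt

/-- The loop quiver of type `Ã₀`: one vertex and one arrow. -/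
instance : Quiver.{0} LoopVertex := ⟨fun _ _ => Unit⟩

/-- The loop arrow. -/
def LoopVertex.loop : LoopVertex.pt ⟶ LoopVertex.pt := ()

/-- The vertices of the crossing paths quiver. -/
inductive CrossVertex : Type
  | v1 | v2 | v3 | v4 | v5

/-- The arrows of the crossing paths quiver. -/
inductive CrossVertex.Arrow : CrossVertex → CrossVertex → Type
  | a : CrossVertex.Arrow .v1 .v3
  | b : CrossVertex.Arrow .v4 .v3
  | c : CrossVertex.Arrow .v3 .v2
  | d : CrossVertex.Arrow .v3 .v5

/-- The quiver of type `D̃₄` with crossing paths: two arrows into the central vertex `v3`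
and two arrows out of it. -/
instance : Quiver.{0} CrossVertex := ⟨CrossVertex.Arrow⟩

/-- The vertices of the quiver of type `Ã₃`. -/
inductive SquareVertex : Type
  | w1 | w2 | w4 | w5

/-- The arrows of the quiver of type `Ã₃`. -/
inductive SquareVertex.Arrow : SquareVertex → SquareVertex → Type
  | a12 : SquareVertex.Arrow .w1 .w2
  | a15 : SquareVertex.Arrow .w1 .w5
  | a42 : SquareVertex.Arrow .w4 .w2
  | a45 : SquareVertex.Arrow .w4 .w5

/-- The quiver of type `Ã₃` with two sources `w1`, `w4` and two sinks `w2`, `w5`. -/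
instance : Quiver.{0} SquareVertex := ⟨SquareVertex.Arrow⟩

namespace QuiverRep

variable {K : Type u} [Field K]

/-- The vertices of the square quiver as vertices of the crossing paths quiver. -/
def squareToCross : SquareVertex → CrossVertex
  | .w1 => .v1
  | .w2 => .v2
  | .w4 => .v4
  | .w5 => .v5

/-- The pullback of a representation of the crossing paths quiver to the square quiver, along the
map sending each arrow of the square to the path of length two with the same endpoints. -/
def crossPullback (M : QuiverRep K CrossVertex) : QuiverRep K SquareVertex where
  space x := M.space (squareToCross x)
  map
    | SquareVertex.Arrow.a12 =>
      M.map CrossVertex.Arrow.c ∘ₗ M.map CrossVertex.Arrow.a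
    | SquareVertex.Arrow.a15 =>
      M.map CrossVertex.Arrow.d ∘ₗ M.map CrossVertex.Arrow.a
    | SquareVertex.Arrow.a42 =>
      M.map CrossVertex.Arrow.c ∘ₗ M.map CrossVertex.Arrow.b
    | SquareVertex.Arrow.a45 =>
      M.map CrossVertex.Arrow.d ∘ₗ M.map CrossVertex.Arrow.b

/-- The linear isomorphism of an arrow of a representation all of whose maps are bijective. -/
noncomputable def arrowEquiv {V : Type v} [Quiver.{w} V] (M : QuiverRep K V)
    (h : ∀ (x y : V) (a : x ⟶ y), Function.Bijective (M.map a)) {x y : V} (a : x ⟶ y) :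
    M.space x ≃ₗ[K] M.space y :=
  LinearEquiv.ofBijective (M.map a) (h x y a)

/-- The representation of the loop quiver obtained from a representation of the square quiver with
bijective maps: the space at `w1`, with the endomorphism obtained by traversing the cycle once,
`w1 → w2 ← w4 → w5 ← w1`. -/
noncomputable def loopFunctor (M : QuiverRep K SquareVertex)
    (h : ∀ (x y : SquareVertex) (a : x ⟶ y), Function.Bijective (M.map a)) :
    QuiverRep K LoopVertex where
  space _ := M.space .w1
  map _ :=
    (((M.arrowEquiv h SquareVertex.Arrow.a12).trans
      (M.arrowEquiv h SquareVertex.Arrow.a42).symm).trans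
      ((M.arrowEquiv h SquareVertex.Arrow.a45).trans
      (M.arrowEquiv h SquareVertex.Arrow.a15).symm)).toLinearMap

/-- The composition of the pullback to the square quiver, the global tensor functor of the square
quiver, and the passage to the loop quiver. -/
noncomputable def crossToLoop (M : QuiverRep K CrossVertex) : QuiverRep K LoopVertex :=
  loopFunctor M.crossPullback.globalTensor
    fun _ _ a => M.crossPullback.globalTensor_bijective a

end QuiverRep

/-! ### Quasi-idempotents and finite generation modulo nilpotents. -/

section QuasiIdempotents

/-! The obstruction to finite multiplicative type is an infinite family of quasi-idempotents.
Suppose an arrow `a₀` lies on an undirected cycle. Let `a₀` act on functions on `ZMod n` by the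
shift by one, and all other arrows by the identity (`cyclicRep`, `singleWeight`). The class `c` of
this representation satisfies `c * c = n * c`, and `sectionRank`, which counts compatible families,
takes the value 1 on it. In a reduced ring that is finite over `ℤ` there are finitely many minimal
primes, and modulo each of them `c` is 0 or `n`. Hence for two different sizes the classes become
proportional modulo nilpotents, which contradicts the value 1 (`not_finite_quotient_nilradical`). No
eigenvalues are used, so the field may be finite and its characteristic may divide `n`. This settles
the loop and every quiver with a cycle.

The crossing paths quiver is a tree and needs the ring homomorphism to the representation ring of
the loop, whose image contains the cyclic shifts. The hard point is that the global tensor functor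
respects tensor products (`globalTensor_tensor`). A tensor `f` and a form `φ` on `X ⊗ Y` contract to
an endomorphism of `X` with trace `φ f`. For `f` in an epimorphic subrepresentation and `φ`
vanishing on the kernel of a monomorphic quotient, Fitting's decomposition of these endomorphisms is
compatible with the arrows: the stable images span an epimorphic subrepresentation of the first
factor, and the stable kernels intersect in the kernel of a monomorphic quotient. Nilpotent
contractions have trace zero, which forces `φ f = 0` where required. -/

theorem sub_pow_three_of_mul_self {R : Type*} [CommRing R] {a b x y : R}
    (hx : x * x = a * x) (hy : y * y = b * y) :
    (b * x - a * y) ^ 3 = (a * b) ^ 2 * (b * x - a * y) := by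
  -- In a domain `x` is 0 or `a` and `y` is 0 or `b`, so `b * x - a * y` is 0 or `± a * b`; the
  -- identity holds in general with these explicit coefficients.
  linear_combination (b ^ 3 * x + a * b ^ 3 - 3 * a * b ^ 2 * y) * hx +
    (-a ^ 3 * y - a ^ 3 * b + 3 * a ^ 2 * b * x) * hy

theorem pow_two_mul_add_one_of_pow_three {R : Type*} [CommRing R] {c z : R}
    (h : z ^ 3 = c * z) (k : ℕ) : z ^ (2 * k + 1) = c ^ k * z := by
  induction k with
  | zero => simp
  | succ k ih =>
    calc z ^ (2 * (k + 1) + 1) = z ^ (2 * k + 1) * z ^ 2 := by ring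
      _ = c ^ k * z ^ 3 := by rw [ih]; ring
      _ = c ^ (k + 1) * z := by rw [h]; ring

/-- In a Noetherian ring, among infinitely many elements `x n` with `x n ^ 2 = (n + 1) * x n` two
become proportional modulo the nilradical. -/
theorem exists_sub_mem_nilradical {S : Type*} [CommRing S] [IsNoetherianRing S] (x : ℕ → S)
    (hx : ∀ n, x n * x n = ((n + 1 : ℕ) : S) * x n) :
    ∃ m n, m ≠ n ∧ ((n + 1 : ℕ) : S) * x m - ((m + 1 : ℕ) : S) * x n ∈ nilradical S := by
  have hfin := minimalPrimes.finite_of_isNoetherianRing S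
  have : Finite (Set (minimalPrimes S)) := by
    have := hfin.to_subtype
    infer_instance
  -- Pigeonhole on the set of minimal primes containing `x n`: only finitely many such sets exist.
  obtain ⟨m, n, hmn, h⟩ := Finite.exists_ne_map_eq_of_infinite
    (fun n => {P : minimalPrimes S | x n ∈ P.1})
  refine ⟨m, n, hmn, ?_⟩
  rw [nilradical, ← Ideal.sInf_minimalPrimes, Ideal.mem_sInf]
  intro P hP
  have hprime : P.IsPrime := Ideal.IsMinimalPrime.isPrime hP
  have hiff : x m ∈ P ↔ x n ∈ P := Set.ext_iff.1 h ⟨P, hP⟩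
  by_cases hm : x m ∈ P
  · exact sub_mem (P.mul_mem_left _ hm) (P.mul_mem_left _ (hiff.1 hm))
  -- Modulo a prime that does not contain it, `x k` can be cancelled from its quadratic equation and
  -- equals `k + 1`.
  · have key : ∀ k, x k ∉ P → x k - ((k + 1 : ℕ) : S) ∈ P := fun k hk => by
      refine (hprime.mem_or_mem (x := x k) (y := x k - ((k + 1 : ℕ) : S)) ?_).resolve_left hk
      rw [mul_sub, hx, mul_comm, sub_self]
      exact zero_mem _
    have h1 := P.mul_mem_left ((n + 1 : ℕ) : S) (key m hm)
    have h2 := P.mul_mem_left ((m + 1 : ℕ) : S) (key n fun h => hm (hiff.2 h))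
    convert sub_mem h1 h2 using 1
    ring

/-- Some combination `z = (n + 1) * c m - (m + 1) * c n` with `m ≠ n` is nilpotent. Since `z ^ 3` is
a positive integer times `z`, nilpotency makes `z` torsion, so `h z = n - m` would have to vanish.
-/
theorem not_finite_quotient_nilradical {R : Type*} [CommRing R] (c : ℕ → R)
    (hc : ∀ n, c n * c n = ((n + 1 : ℕ) : R) * c n) (h : R →+ ℤ) (h1 : ∀ n, h (c n) = 1) :
    ¬ Module.Finite ℤ (R ⧸ nilradical R) := by
  intro hfin
  have : IsNoetherianRing (R ⧸ nilradical R) := IsNoetherianRing.of_finite ℤ _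
  obtain ⟨m, n, hmn, hz⟩ := exists_sub_mem_nilradical
    (fun n => Ideal.Quotient.mk (nilradical R) (c n)) fun n => by
      rw [← map_mul, hc, map_mul, map_natCast]
  set z : R := ((n + 1 : ℕ) : R) * c m - ((m + 1 : ℕ) : R) * c n with hzdef
  have hz' : Ideal.Quotient.mk (nilradical R) z ∈ nilradical (R ⧸ nilradical R) := by
    simpa [hzdef] using hz
  have hnil : IsNilpotent z := by
    obtain ⟨k, hk⟩ := mem_nilradical.1 hz'
    rw [← map_pow, Ideal.Quotient.eq_zero_iff_mem] at hk
    obtain ⟨l, hl⟩ := hk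
    exact ⟨k * l, by rw [pow_mul, hl]⟩
  obtain ⟨k, hk⟩ := hnil
  have hpow := pow_two_mul_add_one_of_pow_three (sub_pow_three_of_mul_self (hc m) (hc n)) k
  rw [show 2 * k + 1 = k + (k + 1) by ring, pow_add, hk, zero_mul] at hpow
  have h0 : h (((((m + 1) * (n + 1)) ^ 2) ^ k : ℕ) • z) = 0 := by
    rw [nsmul_eq_mul]
    push_cast
    push_cast at hpow hzdef
    rw [hzdef, ← hpow, map_zero]
  have hzv : h z = (n : ℤ) - m := by
    rw [hzdef, ← nsmul_eq_mul, ← nsmul_eq_mul, map_sub, map_nsmul, map_nsmul, h1, h1]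
    simp
  rw [map_nsmul, hzv, nsmul_eq_mul, mul_eq_zero] at h0
  rcases h0 with h0 | h0
  · exact absurd h0 (by positivity)
  · omega

/-- Ring homomorphisms preserve nilpotents, so finiteness passes to the image. Preimages of
quasi-idempotents need not be quasi-idempotent, so the obstruction is applied in the image. -/
theorem Module.Finite.range_quotient_nilradical {A R : Type*} [CommRing A] [CommRing R]
    (φ : A →+* R) [Module.Finite ℤ (A ⧸ nilradical A)] :
    Module.Finite ℤ (φ.range ⧸ nilradical φ.range) := by
  let ψ : A ⧸ nilradical A →+* φ.range ⧸ nilradical φ.range :=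
    Ideal.quotientMap _ φ.rangeRestrict fun a ha => by
      rw [Ideal.mem_comap, mem_nilradical]
      exact (mem_nilradical.1 ha).map _
  refine Module.Finite.of_surjective ψ.toAddMonoidHom.toIntLinearMap ?_
  exact Ideal.quotientMap_surjective (f := φ.rangeRestrict) (H := fun a ha => by
    rw [Ideal.mem_comap, mem_nilradical]
    exact (mem_nilradical.1 ha).map _) φ.rangeRestrict_surjective

end QuasiIdempotents

/-! ### Contraction of a tensor with a linear form. -/

namespace TensorProduct

variable {K : Type*} [Field K] {X Y X' Y' : Type*} [AddCommGroup X] [Module K X]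
  [AddCommGroup Y] [Module K Y] [AddCommGroup X'] [Module K X'] [AddCommGroup Y'] [Module K Y']

/-- A tensor as a linear map on the dual space of the second factor. -/
noncomputable def dualContract (f : TensorProduct K X Y) : Module.Dual K Y →ₗ[K] X :=
  (TensorProduct.rid K X).toLinearMap ∘ₗ (LinearMap.lTensorHom X).flip f

@[simp]
theorem dualContract_tmul (a : X) (b : Y) (η : Module.Dual K Y) :
    dualContract (a ⊗ₜ[K] b) η = η b • a := by
  simp [dualContract]

theorem dualContract_add (f g : TensorProduct K X Y) :
    dualContract (f + g) = dualContract f + dualContract g := by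
  simp [dualContract, LinearMap.comp_add]

@[simp]
theorem dualContract_zero : dualContract (0 : TensorProduct K X Y) = 0 := by
  simp [dualContract]

/-- The endomorphism of the first factor obtained by contracting the second one in a tensor and a
linear form on the tensor product. -/
noncomputable def contractEnd (f : TensorProduct K X Y)
    (φ : Module.Dual K (TensorProduct K X Y)) : Module.End K X :=
  dualContract f ∘ₗ curry φ

theorem contractEnd_tmul_apply (a : X) (b : Y) (φ : Module.Dual K (TensorProduct K X Y)) (x : X) :
    contractEnd (a ⊗ₜ[K] b) φ x = φ (x ⊗ₜ b) • a := by
  simp [contractEnd]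

theorem contractEnd_add (f g : TensorProduct K X Y) (φ : Module.Dual K (TensorProduct K X Y)) :
    contractEnd (f + g) φ = contractEnd f φ + contractEnd g φ := by
  simp [contractEnd, dualContract_add, LinearMap.add_comp]

@[simp]
theorem contractEnd_zero (φ : Module.Dual K (TensorProduct K X Y)) :
    contractEnd (0 : TensorProduct K X Y) φ = 0 := by
  simp [contractEnd]

/-- For a pure tensor the contraction has rank at most one and the trace is an evaluation; the rest
is linearity in `f`. This turns nilpotency statements into the vanishing of `φ f`. -/
theorem trace_contractEnd [FiniteDimensional K X] (f : TensorProduct K X Y)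
    (φ : Module.Dual K (TensorProduct K X Y)) :
    LinearMap.trace K X (contractEnd f φ) = φ f := by
  induction f using TensorProduct.induction_on with
  | zero => simp
  | tmul a b =>
    have : contractEnd (a ⊗ₜ[K] b) φ = ((curry φ).flip b).smulRight a := by
      ext x
      simp [contractEnd_tmul_apply]
    rw [this, LinearMap.trace_smulRight]
    simp
  | add f g hf hg => rw [contractEnd_add, map_add, map_add, hf, hg]

theorem eq_zero_of_isNilpotent_contractEnd [FiniteDimensional K X] {f : TensorProduct K X Y}
    {φ : Module.Dual K (TensorProduct K X Y)} (h : IsNilpotent (contractEnd f φ)) : φ f = 0 := by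
  rw [← trace_contractEnd]
  exact (LinearMap.isNilpotent_trace_of_isNilpotent h).eq_zero

theorem dualContract_map (A : X →ₗ[K] X') (B : Y →ₗ[K] Y') (f : TensorProduct K X Y) :
    dualContract (map A B f) = A ∘ₗ dualContract f ∘ₗ Module.Dual.transpose B := by
  induction f using TensorProduct.induction_on with
  | zero => simp
  | tmul a b => ext η; simp [Module.Dual.transpose_apply]
  | add f g hf hg =>
    rw [map_add, dualContract_add, hf, hg, dualContract_add, LinearMap.add_comp, LinearMap.comp_add]

/-- The connecting map between the contractions before and after applying linear maps to the
factors. -/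
noncomputable def contractConnect (B : Y →ₗ[K] Y') (f : TensorProduct K X Y)
    (φ : Module.Dual K (TensorProduct K X' Y')) : X' →ₗ[K] X :=
  dualContract f ∘ₗ Module.Dual.transpose B ∘ₗ curry φ

/-- With `contractEnd_comp_map`: moving a pair along an arrow replaces `ψ ∘ₗ A` by `A ∘ₗ ψ` with the
same `ψ`, and such endomorphisms have matching Fitting decompositions. -/
theorem contractEnd_map (A : X →ₗ[K] X') (B : Y →ₗ[K] Y') (f : TensorProduct K X Y)
    (φ : Module.Dual K (TensorProduct K X' Y')) :
    contractEnd (map A B f) φ = A ∘ₗ contractConnect B f φ := by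
  rw [contractEnd, dualContract_map]
  rfl

theorem contractEnd_comp_map (A : X →ₗ[K] X') (B : Y →ₗ[K] Y') (f : TensorProduct K X Y)
    (φ : Module.Dual K (TensorProduct K X' Y')) :
    contractEnd f (φ ∘ₗ map A B) = contractConnect B f φ ∘ₗ A := by
  rw [contractEnd, contractConnect]
  ext x
  have : curry (φ ∘ₗ map A B) x = Module.Dual.transpose B (curry φ (A x)) := by
    ext y
    simp [Module.Dual.transpose_apply]
  simp [this]

/-- The contractions on the two factors are adjoint for the pairing `φ`, so powers can be shifted
from one factor to the other. -/
theorem apply_contractEnd_tmul (f : TensorProduct K X Y)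
    (φ : Module.Dual K (TensorProduct K X Y)) (x : X) (y : Y) :
    φ (contractEnd f φ x ⊗ₜ y) =
      φ (x ⊗ₜ contractEnd (TensorProduct.comm K X Y f)
        (φ ∘ₗ (TensorProduct.comm K X Y).symm.toLinearMap) y) := by
  induction f using TensorProduct.induction_on with
  | zero => simp
  | tmul a b =>
    simp only [contractEnd_tmul_apply, comm_tmul, LinearMap.comp_apply, LinearEquiv.coe_coe,
      comm_symm_tmul, TensorProduct.tmul_smul, ← TensorProduct.smul_tmul', map_smul, smul_eq_mul]
    ring
  | add f g hf hg =>
    simp only [contractEnd_add, map_add, LinearMap.add_apply, TensorProduct.add_tmul,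
      TensorProduct.tmul_add, hf, hg]

theorem apply_contractEnd_pow_tmul (f : TensorProduct K X Y)
    (φ : Module.Dual K (TensorProduct K X Y)) (k : ℕ) (x : X) (y : Y) :
    φ ((contractEnd f φ ^ k) x ⊗ₜ y) =
      φ (x ⊗ₜ (contractEnd (TensorProduct.comm K X Y f)
        (φ ∘ₗ (TensorProduct.comm K X Y).symm.toLinearMap) ^ k) y) := by
  induction k generalizing y with
  | zero => simp
  | succ k ih =>
    rw [pow_succ', Module.End.mul_apply, apply_contractEnd_tmul, ih, pow_succ, Module.End.mul_apply]

theorem contractEnd_apply_mem {f : TensorProduct K X Y} {P : Submodule K X} {Q : Submodule K Y}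
    (hf : f ∈ LinearMap.range (map P.subtype Q.subtype))
    (φ : Module.Dual K (TensorProduct K X Y)) (x : X) : contractEnd f φ x ∈ P := by
  obtain ⟨g, rfl⟩ := hf
  induction g using TensorProduct.induction_on with
  | zero => simp
  | tmul a b =>
    rw [map_tmul, contractEnd_tmul_apply]
    exact P.smul_mem _ a.2
  | add f g hf hg =>
    rw [map_add, contractEnd_add]
    exact add_mem hf hg

end TensorProduct

/-! ### Fitting decompositions of `A ∘ₗ ψ` and `ψ ∘ₗ A`. -/

namespace LinearMap

variable {K : Type*} [Field K] {X Y : Type*} [AddCommGroup X] [Module K X]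
  [AddCommGroup Y] [Module K Y]

/-- The intersection of the images of the powers of an endomorphism. -/
def stableRange (θ : Module.End K X) : Submodule K X := ⨅ k, range (θ ^ k)

/-- The union of the kernels of the powers of an endomorphism. -/
def stableKer (θ : Module.End K X) : Submodule K X := θ.maxGenEigenspace 0

theorem mem_stableKer {θ : Module.End K X} {x : X} : x ∈ stableKer θ ↔ ∃ k, (θ ^ k) x = 0 := by
  simp [stableKer, Module.End.mem_maxGenEigenspace]

theorem exists_pow_apply_mem_of_stableRange_le [FiniteDimensional K X] {θ : Module.End K X}
    {P : Submodule K X} (h : stableRange θ ≤ P) : ∃ k, ∀ x, (θ ^ k) x ∈ P := by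
  obtain ⟨k, hk⟩ := (eventually_iInf_range_pow_eq θ).exists
  exact ⟨k, fun x => h (by rw [stableRange, hk]; exact mem_range_self _ x)⟩

theorem exists_pow_apply_eq_zero_of_le_stableKer [FiniteDimensional K X] {θ : Module.End K X}
    {P : Submodule K X} (h : P ≤ stableKer θ) : ∃ k, ∀ x ∈ P, (θ ^ k) x = 0 := by
  refine ⟨Module.finrank K X, fun x hx => ?_⟩
  have := h hx
  rw [stableKer, Module.End.maxGenEigenspace_eq_genEigenspace_finrank,
    Module.End.mem_genEigenspace_nat] at this
  simpa using this

theorem comp_pow_comp (A : X →ₗ[K] Y) (ψ : Y →ₗ[K] X) (k : ℕ) :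
    A ∘ₗ ((ψ ∘ₗ A : Module.End K X) ^ k) = ((A ∘ₗ ψ : Module.End K Y) ^ k) ∘ₗ A := by
  induction k with
  | zero => rfl
  | succ k ih =>
    rw [pow_succ, pow_succ, Module.End.mul_eq_comp, Module.End.mul_eq_comp, ← comp_assoc, ih]
    rfl

theorem map_stableRange [FiniteDimensional K X] [FiniteDimensional K Y] (A : X →ₗ[K] Y)
    (ψ : Y →ₗ[K] X) : (stableRange (ψ ∘ₗ A)).map A = stableRange (A ∘ₗ ψ) := by
  obtain ⟨k, hk, hk'⟩ := ((eventually_iInf_range_pow_eq (ψ ∘ₗ A)).and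
    ((Filter.tendsto_add_atTop_nat 1).eventually
      (eventually_iInf_range_pow_eq (A ∘ₗ ψ)))).exists
  apply le_antisymm
  · refine le_iInf fun l => ?_
    refine (Submodule.map_mono (iInf_le _ l)).trans ?_
    rw [← range_comp, comp_pow_comp]
    exact range_comp_le_range _ _
  -- The exponent `k + 1` provides the extra factor: `(A ψ) ^ (k + 1) = A (ψ A) ^ k ψ`, whose range
  -- lies in the image under `A` of the range of `(ψ A) ^ k`.
  · rw [stableRange, stableRange, hk, hk', pow_succ, Module.End.mul_eq_comp, ← comp_assoc,
      ← comp_pow_comp, ← range_comp]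
    exact range_comp_le_range _ _

theorem comap_stableKer (A : X →ₗ[K] Y) (ψ : Y →ₗ[K] X) :
    (stableKer (A ∘ₗ ψ)).comap A = stableKer (ψ ∘ₗ A) := by
  ext x
  rw [Submodule.mem_comap, mem_stableKer, mem_stableKer]
  have h : ∀ k, ((A ∘ₗ ψ : Module.End K Y) ^ k) (A x) = A (((ψ ∘ₗ A : Module.End K X) ^ k) x) :=
    fun k => (LinearMap.congr_fun (comp_pow_comp A ψ k) x).symm
  constructor
  · rintro ⟨k, hk⟩
    refine ⟨k + 1, ?_⟩
    rw [h] at hk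
    rw [pow_succ', Module.End.mul_apply, comp_apply, hk, map_zero]
  · rintro ⟨k, hk⟩
    exact ⟨k, by rw [h, hk, map_zero]⟩

end LinearMap

/-! ### Homomorphisms out of the representation ring, and cyclic representations. -/

namespace QuiverRep

section Lift

variable {K : Type u} [Field K] {V : Type v} [Quiver.{w} V]

/-- An isomorphism invariant of representations as a function of the isomorphism class. -/
def IsoClass.lift {A : Type*} (F : QuiverRep K V → A)
    (hiso : ∀ M N : QuiverRep K V, IsIso M N → F M = F N) : IsoClass K V → A :=
  Quotient.lift (s := isoSetoid K V) F hiso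

/-- An additive isomorphism invariant of representations as a homomorphism on the representation
ring. -/
noncomputable def RepRing.liftAdd {A : Type*} [AddCommGroup A] (F : QuiverRep K V → A)
    (hiso : ∀ M N : QuiverRep K V, IsIso M N → F M = F N)
    (hsum : ∀ M N : QuiverRep K V, F (M.directSum N) = F M + F N) : RepRing K V →+ A :=
  QuotientAddGroup.lift (sumIdeal K V).toAddSubgroup
    (FreeAbelianGroup.lift (IsoClass.lift F hiso)) fun z hz => by
      change z ∈ AddSubgroup.closure _ at hz
      refine (AddSubgroup.closure_le _).2 ?_ hz
      rintro _ ⟨M, N, rfl⟩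
      have h : ∀ P : QuiverRep K V, FreeAbelianGroup.lift (IsoClass.lift F hiso)
          (FreeAbelianGroup.of (toIsoClass P)) = F P := fun P => FreeAbelianGroup.lift_apply_of ..
      rw [SetLike.mem_coe, AddMonoidHom.mem_ker, map_sub, map_add, h, h, h, hsum, sub_self]

theorem RepRing.liftAdd_cls {A : Type*} [AddCommGroup A] (F : QuiverRep K V → A)
    (hiso : ∀ M N : QuiverRep K V, IsIso M N → F M = F N)
    (hsum : ∀ M N : QuiverRep K V, F (M.directSum N) = F M + F N) (M : QuiverRep K V) :
    RepRing.liftAdd F hiso hsum M.cls = F M :=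
  FreeAbelianGroup.lift_apply_of ..

theorem cls_eq_of_isIso {M N : QuiverRep K V} (h : IsIso M N) : M.cls = N.cls := by
  have : toIsoClass M = toIsoClass N := Quotient.sound h
  rw [cls, cls, this]

theorem cls_directSum (M N : QuiverRep K V) : (M.directSum N).cls = M.cls + N.cls := by
  rw [cls, cls, cls, ← map_add, eq_comm, Ideal.Quotient.eq]
  exact AddSubgroup.subset_closure ⟨M, N, rfl⟩

theorem cls_tensor (M N : QuiverRep K V) : (M.tensor N).cls = M.cls * N.cls := by
  rw [cls, cls, cls, ← map_mul, ← FreeAbelianGroup.of_mul]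
  rfl

theorem cls_one : (one K V).cls = 1 := rfl

/-- An isomorphism invariant of representations that is compatible with sums and products as a
ring homomorphism on the representation ring. -/
noncomputable def RepRing.lift {R : Type*} [CommRing R] (F : QuiverRep K V → R)
    (hiso : ∀ M N : QuiverRep K V, IsIso M N → F M = F N)
    (hsum : ∀ M N : QuiverRep K V, F (M.directSum N) = F M + F N)
    (hone : F (one K V) = 1)
    (hmul : ∀ M N : QuiverRep K V, F (M.tensor N) = F M * F N) : RepRing K V →+* R :=
  Ideal.Quotient.lift (sumIdeal K V) (FreeAbelianGroup.liftMonoid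
    { toFun := IsoClass.lift F hiso
      map_one' := hone
      map_mul' := by
        rintro ⟨M⟩ ⟨N⟩
        exact hmul M N }) fun z hz => by
      have := congrArg (RepRing.liftAdd F hiso hsum) (Ideal.Quotient.eq_zero_iff_mem.2 hz)
      rwa [map_zero] at this

theorem RepRing.lift_cls {R : Type*} [CommRing R] (F : QuiverRep K V → R)
    (hiso : ∀ M N : QuiverRep K V, IsIso M N → F M = F N)
    (hsum : ∀ M N : QuiverRep K V, F (M.directSum N) = F M + F N)
    (hone : F (one K V) = 1)
    (hmul : ∀ M N : QuiverRep K V, F (M.tensor N) = F M * F N) (M : QuiverRep K V) :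
    RepRing.lift F hiso hsum hone hmul M.cls = F M :=
  FreeAbelianGroup.lift_apply_of ..

/-- The direct sum of copies of a representation. -/
def copies (ι : Type) [Finite ι] (M : QuiverRep K V) : QuiverRep K V where
  space x := ι → M.space x
  map a := (M.map a).compLeft ι

theorem cls_copies_fin (n : ℕ) (M : QuiverRep K V) : (copies (Fin n) M).cls = n • M.cls := by
  induction n with
  | zero =>
    -- The zero representation is isomorphic to its own double, so its class `c` satisfies `c = c +
    -- c`.
    have h : IsIso (copies (Fin 0) M) ((copies (Fin 0) M).directSum (copies (Fin 0) M)) := by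
      refine ⟨fun x => ⟨0, 0, fun _ => Subsingleton.elim (α := Fin 0 → M.space x) _ _,
        fun p => ?_⟩, fun x y a m => ?_⟩
      · exact Subsingleton.elim (α := (Fin 0 → M.space x) × (Fin 0 → M.space x)) _ _
      · exact Subsingleton.elim (α := (Fin 0 → M.space y) × (Fin 0 → M.space y)) _ _
    have h' := cls_eq_of_isIso h
    rw [cls_directSum] at h'
    rw [zero_smul]
    exact left_eq_add.1 h'
  | succ n ih =>
    rw [succ_nsmul', ← ih, ← cls_directSum]
    exact cls_eq_of_isIso ⟨fun x => (Fin.consLinearEquiv K fun _ => M.space x).symm,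
      fun x y a m => rfl⟩

end Lift

section CyclicRep

variable (K : Type u) [Field K] {V : Type v} [Quiver.{w} V]

/-- The representation by functions on `ZMod n` where each arrow acts by the shift by its
weight. -/
def cyclicRep (n : ℕ) [NeZero n] (wt : ∀ x y : V, (x ⟶ y) → ZMod n) : QuiverRep K V where
  space _ := ZMod n → K
  map {x y} a := LinearMap.funLeft K K fun i => i + wt x y a

/-- The tensor square consists of functions on pairs, and every arrow shifts both coordinates
equally. It therefore preserves their difference, and each of the `n` differences carries one copy.
-/
theorem cyclicRep_tensor (n : ℕ) [NeZero n] (wt : ∀ x y : V, (x ⟶ y) → ZMod n) :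
    IsIso ((cyclicRep K n wt).tensor (cyclicRep K n wt))
      (copies (Fin n) (cyclicRep K n wt)) := by
  let σ : (ZMod n × Fin n) ≃ (ZMod n × ZMod n) :=
    { toFun := fun p => (p.1, p.1 + (ZMod.finEquiv n p.2))
      invFun := fun p => (p.1, (ZMod.finEquiv n).symm (p.2 - p.1))
      left_inv := fun p => by simp
      right_inv := fun p => by simp }
  let e : TensorProduct K (ZMod n → K) (ZMod n → K) ≃ₗ[K] (Fin n → ZMod n → K) :=
    (TensorProduct.piScalarRight K K (ZMod n → K) (ZMod n)).trans <|
      (LinearEquiv.curry K K (ZMod n) (ZMod n)).symm.trans <|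
      (LinearEquiv.funCongrLeft K K ((Equiv.prodComm _ _).trans (σ.trans (Equiv.prodComm _ _)))).trans
        (LinearEquiv.curry K K (Fin n) (ZMod n))
  have he : ∀ (f g : ZMod n → K) (k : Fin n) (i : ZMod n),
      e (f ⊗ₜ g) k i = f i * g (i + ZMod.finEquiv n k) := fun f g k i => by
    simp [e, σ, LinearEquiv.funCongrLeft_apply, LinearMap.funLeft_apply, mul_comm]
  refine ⟨fun _ => e, fun x y a m => ?_⟩
  change TensorProduct K (ZMod n → K) (ZMod n → K) at m
  change e (TensorProduct.map (LinearMap.funLeft K K fun i => i + wt x y a)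
      (LinearMap.funLeft K K fun i => i + wt x y a) m) =
    (LinearMap.funLeft K K fun i => i + wt x y a).compLeft (Fin n) (e m)
  induction m using TensorProduct.induction_on with
  | zero => simp only [map_zero]
  | tmul f g =>
    ext k i
    change e (TensorProduct.map _ _ (f ⊗ₜ g)) k i = e (f ⊗ₜ g) k (i + wt x y a)
    rw [TensorProduct.map_tmul, he, he, LinearMap.funLeft_apply, LinearMap.funLeft_apply,
      add_right_comm]
  | add p q hp hq => simp only [map_add, hp, hq]

theorem cls_cyclicRep_mul_self (n : ℕ) [NeZero n] (wt : ∀ x y : V, (x ⟶ y) → ZMod n) :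
    (cyclicRep K n wt).cls * (cyclicRep K n wt).cls = (n : RepRing K V) * (cyclicRep K n wt).cls := by
  rw [← cls_tensor, cls_eq_of_isIso (cyclicRep_tensor K n wt), cls_copies_fin, nsmul_eq_mul]

variable {K}

theorem _root_.Submodule.finrank_prod {X Y : Type*} [AddCommGroup X] [Module K X]
    [AddCommGroup Y] [Module K Y] (P : Submodule K X) (Q : Submodule K Y)
    [FiniteDimensional K P] [FiniteDimensional K Q] :
    Module.finrank K (P.prod Q) = Module.finrank K P + Module.finrank K Q := by
  rw [← Module.finrank_prod]
  exact LinearEquiv.finrank_eq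
    { toFun := fun p => (⟨p.1.1, p.2.1⟩, ⟨p.1.2, p.2.2⟩)
      invFun := fun p => ⟨(p.1.1, p.2.1), p.1.2, p.2.2⟩
      map_add' := fun _ _ => rfl
      map_smul' := fun _ _ => rfl
      left_inv := fun _ => rfl
      right_inv := fun _ => rfl }

/-- The values at a vertex of the families of vectors that are compatible with all arrows. -/
def sectionSpace (x₀ : V) (M : QuiverRep K V) : Submodule K (M.space x₀) where
  carrier := {m | ∃ s : ∀ x, M.space x, (∀ (x y : V) (a : x ⟶ y), M.map a (s x) = s y) ∧ s x₀ = m}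
  zero_mem' := ⟨fun _ => 0, fun _ _ _ => map_zero _, rfl⟩
  add_mem' := by
    rintro _ _ ⟨s, hs, rfl⟩ ⟨t, ht, rfl⟩
    exact ⟨fun x => s x + t x, fun x y a => by rw [map_add, hs, ht], rfl⟩
  smul_mem' := by
    rintro c _ ⟨s, hs, rfl⟩
    exact ⟨fun x => c • s x, fun x y a => by rw [map_smul, hs], rfl⟩

theorem finrank_sectionSpace_congr (x₀ : V) {M N : QuiverRep K V} (h : IsIso M N) :
    Module.finrank K (sectionSpace x₀ M) = Module.finrank K (sectionSpace x₀ N) := by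
  obtain ⟨e, he⟩ := h
  have : (sectionSpace x₀ M).map (e x₀).toLinearMap = sectionSpace x₀ N := by
    ext n
    constructor
    · rintro ⟨_, ⟨s, hs, rfl⟩, rfl⟩
      exact ⟨fun x => e x (s x), fun x y a => by rw [← he, hs], rfl⟩
    · rintro ⟨s, hs, rfl⟩
      refine ⟨_, ⟨fun x => (e x).symm (s x), fun x y a => ?_, rfl⟩, by simp⟩
      rw [LinearEquiv.eq_symm_apply, he, LinearEquiv.apply_symm_apply, hs]
  rw [← this]
  exact ((e x₀).submoduleMap (sectionSpace x₀ M)).finrank_eq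

theorem finrank_sectionSpace_directSum (x₀ : V) (M N : QuiverRep K V) :
    Module.finrank K (sectionSpace x₀ (M.directSum N)) =
      Module.finrank K (sectionSpace x₀ M) + Module.finrank K (sectionSpace x₀ N) := by
  have : sectionSpace x₀ (M.directSum N) = (sectionSpace x₀ M).prod (sectionSpace x₀ N) := by
    ext p
    constructor
    · rintro ⟨s, hs, rfl⟩
      exact ⟨⟨fun x => (s x).1, fun x y a => congrArg Prod.fst (hs x y a), rfl⟩,
        ⟨fun x => (s x).2, fun x y a => congrArg Prod.snd (hs x y a), rfl⟩⟩
    · rintro ⟨⟨s, hs, hs'⟩, ⟨t, ht, ht'⟩⟩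
      exact ⟨fun x => (s x, t x), fun x y a => Prod.ext (hs x y a) (ht x y a), Prod.ext hs' ht'⟩
  rw [this]
  exact Submodule.finrank_prod _ _

/-- Two vertices are joined by a path in the underlying graph that avoids the arrow `a₀`. -/
def JoinedAvoiding {x₀ y₀ : V} (a₀ : x₀ ⟶ y₀) : V → V → Prop :=
  Relation.EqvGen fun x y => ∃ a : x ⟶ y, (⟨x, y, a⟩ : Σ x y : V, x ⟶ y) ≠ ⟨x₀, y₀, a₀⟩

open Classical in
/-- The weight that is one at a given arrow and zero at the others. -/
noncomputable def singleWeight {x₀ y₀ : V} (a₀ : x₀ ⟶ y₀) (n : ℕ) (x y : V) (a : x ⟶ y) : ZMod n :=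
  if (⟨x, y, a⟩ : Σ x y : V, x ⟶ y) = ⟨x₀, y₀, a₀⟩ then 1 else 0

/-- A compatible family is unchanged along arrows of weight zero, so it has the same value at both
ends of `a₀`. The arrow `a₀` itself then makes this value invariant under the shift by one, hence
constant. -/
theorem finrank_sectionSpace_cyclicRep {x₀ y₀ : V} (a₀ : x₀ ⟶ y₀) (h : JoinedAvoiding a₀ x₀ y₀)
    (n : ℕ) [NeZero n] :
    Module.finrank K (sectionSpace x₀ (cyclicRep K n (singleWeight a₀ n))) = 1 := by
  let P : Submodule K (ZMod n → K) := sectionSpace x₀ (cyclicRep K n (singleWeight a₀ n))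
  change Module.finrank K P = 1
  have : P = Submodule.span K {(fun _ => 1 : ZMod n → K)} := by
    refine Submodule.ext fun m => Iff.trans ?_ Submodule.mem_span_singleton.symm
    constructor
    · rintro ⟨s, hs, rfl⟩
      change ∀ x, ZMod n → K at s
      have hs' : ∀ (x y : V) (a : x ⟶ y) (i : ZMod n), s x (i + singleWeight a₀ n x y a) = s y i :=
        fun x y a i => congrFun (hs x y a) i
      have hconst : ∀ x y, JoinedAvoiding a₀ x y → s x = s y := fun x y hxy => by
        induction hxy with
        | rel x y hxy =>
          obtain ⟨a, ha⟩ := hxy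
          ext i
          rw [← hs' x y a, singleWeight, if_neg ha, add_zero]
        | refl x => rfl
        | symm x y _ ih => exact ih.symm
        | trans x y z _ _ ih ih' => exact ih.trans ih'
      have hshift : ∀ i, s x₀ (i + 1) = s x₀ i := fun i => by
        conv_rhs => rw [hconst _ _ h, ← hs' x₀ y₀ a₀, singleWeight, if_pos rfl]
      refine ⟨s x₀ 0, funext fun i => ?_⟩
      have hi : ∀ k : ℕ, s x₀ k = s x₀ 0 := fun k => by
        induction k with
        | zero => simp
        | succ k ih => rw [Nat.cast_succ, hshift, ih]
      have := hi i.val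
      rw [ZMod.natCast_zmod_val] at this
      simp [this]
    · rintro ⟨c, rfl⟩
      exact ⟨fun _ => c • (fun _ => 1), fun x y a => rfl, rfl⟩
  rw [this]
  exact finrank_span_singleton fun h => one_ne_zero (congrFun h 0)

/-- The dimension of the space of values at a vertex of the compatible families of vectors, as a
homomorphism on the representation ring. -/
noncomputable def sectionRank (x₀ : V) : RepRing K V →+ ℤ :=
  RepRing.liftAdd (fun M => (Module.finrank K (sectionSpace x₀ M) : ℤ))
    (fun _ _ h => by rw [finrank_sectionSpace_congr x₀ h])
    (fun M N => by rw [finrank_sectionSpace_directSum, Nat.cast_add])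

theorem sectionRank_cls (x₀ : V) (M : QuiverRep K V) :
    sectionRank x₀ M.cls = Module.finrank K (sectionSpace x₀ M) :=
  RepRing.liftAdd_cls ..

theorem not_finite_of_cyclicRep_mem_range {A : Type*} [CommRing A] (φ : A →+* RepRing K V)
    {x₀ y₀ : V} (a₀ : x₀ ⟶ y₀) (h : JoinedAvoiding a₀ x₀ y₀)
    (hmem : ∀ n : ℕ, (cyclicRep K (n + 1) (singleWeight a₀ (n + 1))).cls ∈ φ.range) :
    ¬ Module.Finite ℤ (A ⧸ nilradical A) := by
  intro hfin
  have := Module.Finite.range_quotient_nilradical φ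
  refine not_finite_quotient_nilradical (R := φ.range) (fun n => ⟨_, hmem n⟩)
    (fun n => Subtype.ext ?_)
    ((sectionRank x₀).comp φ.range.subtype.toAddMonoidHom) (fun n => ?_) this
  · simpa using cls_cyclicRep_mul_self K (n + 1) (singleWeight a₀ (n + 1))
  · change sectionRank x₀ (cyclicRep K (n + 1) (singleWeight a₀ (n + 1))).cls = 1
    rw [sectionRank_cls, finrank_sectionSpace_cyclicRep a₀ h, Nat.cast_one]

theorem not_finiteMultiplicativeType_of_joinedAvoiding {x₀ y₀ : V} (a₀ : x₀ ⟶ y₀)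
    (h : JoinedAvoiding a₀ x₀ y₀) : ¬ FiniteMultiplicativeType K V :=
  not_finite_of_cyclicRep_mem_range (RingHom.id _) a₀ h fun _ => ⟨_, rfl⟩

end CyclicRep

end QuiverRep

/-! ### Quivers in which every arrow is a bridge. -/

section Forest

variable {V : Type v} [Quiver.{w} V]

theorem isForestQuiver_of_not_joinedAvoiding
    (h : ∀ (x y : V) (a : x ⟶ y), ¬ QuiverRep.JoinedAvoiding a x y) : IsForestQuiver V := by
  have hloop : ∀ x : V, IsEmpty (x ⟶ x) := fun x => ⟨fun a => h x x a (.refl x)⟩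
  have hne : ∀ {x y : V}, (x ⟶ y) → x ≠ y := fun {x y} a hxy => by
    subst hxy
    exact (hloop x).false a
  refine ⟨hloop, fun x y => ⟨?_⟩, ?_⟩
  · rintro (a | a) (b | b)
    · by_contra hab
      exact h x y a (.rel _ _ ⟨b, fun e => hab (by cases e; rfl)⟩)
    · exact (h x y a (.symm _ _ (.rel _ _ ⟨b, fun e => hne a (congrArg Sigma.fst e).symm⟩))).elim
    · exact (h x y b (.symm _ _ (.rel _ _ ⟨a, fun e => hne b (congrArg Sigma.fst e).symm⟩))).elim
    · by_contra hab
      exact h y x a (.rel _ _ ⟨b, fun e => hab (by cases e; rfl)⟩)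
  -- Deleting the edge removes all arrows between `x` and `y`, so a walk in the remaining graph
  -- lifts to arrows other than `a`.
  · have key : ∀ (x y : V) (a : x ⟶ y),
        ¬ ((QuiverGraph V).deleteEdges {s(x, y)}).Reachable x y := fun x y a hr => by
      refine h x y a ?_
      rw [SimpleGraph.reachable_iff_reflTransGen] at hr
      have : ∀ z, Relation.ReflTransGen ((QuiverGraph V).deleteEdges {s(x, y)}).Adj x z →
          QuiverRep.JoinedAvoiding a x z := fun z hz => by
        induction hz with
        | refl => exact .refl x
        | tail _ hz ih =>
          refine .trans _ _ _ ih ?_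
          rw [SimpleGraph.deleteEdges_adj] at hz
          obtain ⟨hadj, hnot⟩ := hz
          rw [QuiverGraph, SimpleGraph.fromRel_adj] at hadj
          rcases hadj.2 with ⟨⟨b⟩⟩ | ⟨⟨b⟩⟩
          · exact .rel _ _ ⟨b, fun e => hnot (by cases e; rfl)⟩
          · exact .symm _ _ (.rel _ _ ⟨b, fun e => hnot (by cases e; exact Sym2.eq_swap)⟩)
      exact this y hr
    rw [SimpleGraph.isAcyclic_iff_forall_adj_isBridge]
    intro x y hxy
    rw [SimpleGraph.isBridge_iff]
    rw [QuiverGraph, SimpleGraph.fromRel_adj] at hxy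
    rcases hxy.2 with ⟨⟨a⟩⟩ | ⟨⟨a⟩⟩
    · exact key x y a
    · intro hr
      rw [Sym2.eq_swap] at hr
      exact key y x a hr.symm

end Forest

/-! ### Subspaces and kernels in tensor products. -/

namespace TensorProduct

variable {K : Type*} [Field K] {X Y X' Y' : Type*} [AddCommGroup X] [Module K X]
  [AddCommGroup Y] [Module K Y] [AddCommGroup X'] [Module K X'] [AddCommGroup Y'] [Module K Y']

/-- The map induced by `A` on the quotients by `P` and `Q` is injective, and over a field it has a
left inverse along which forms extend. -/
theorem _root_.Submodule.exists_dual_comp_eq {A : X →ₗ[K] Y} {P : Submodule K X}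
    {Q : Submodule K Y} (h : Q.comap A = P) {φ : Module.Dual K X} (hφ : P ≤ LinearMap.ker φ) :
    ∃ φ' : Module.Dual K Y, Q ≤ LinearMap.ker φ' ∧ φ = φ' ∘ₗ A := by
  have hker : LinearMap.ker (P.mapQ Q A h.ge) = ⊥ := by
    rw [Submodule.ker_mapQ, h, Submodule.mkQ_map_self]
  obtain ⟨g, hg⟩ := LinearMap.exists_leftInverse_of_injective _ hker
  refine ⟨P.liftQ φ hφ ∘ₗ g ∘ₗ Q.mkQ, fun z hz => ?_, LinearMap.ext fun z => ?_⟩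
  · rw [LinearMap.mem_ker, LinearMap.comp_apply, LinearMap.comp_apply, Submodule.mkQ_apply,
      (Submodule.Quotient.mk_eq_zero _).2 hz, map_zero, map_zero]
  · exact (congrArg (P.liftQ φ hφ) (LinearMap.congr_fun hg (P.mkQ z))).symm

theorem map_range_map_subtype (A : X →ₗ[K] X') (B : Y →ₗ[K] Y') (P : Submodule K X)
    (Q : Submodule K Y) : (LinearMap.range (map P.subtype Q.subtype)).map (map A B) =
      LinearMap.range (map (P.map A).subtype (Q.map B).subtype) := by
  have h : map A B ∘ₗ map P.subtype Q.subtype =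
      map (P.map A).subtype (Q.map B).subtype ∘ₗ map (A.submoduleMap P) (B.submoduleMap Q) := by
    rw [← map_comp, ← map_comp]
    rfl
  rw [← LinearMap.range_comp, h, LinearMap.range_comp_of_range_eq_top]
  exact LinearMap.range_eq_top.2
    (map_surjective (A.submoduleMap_surjective P) (B.submoduleMap_surjective Q))

theorem comm_mem_range_map_subtype {P : Submodule K X} {Q : Submodule K Y}
    {f : TensorProduct K X Y} (hf : f ∈ LinearMap.range (map P.subtype Q.subtype)) :
    TensorProduct.comm K X Y f ∈ LinearMap.range (map Q.subtype P.subtype) := by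
  obtain ⟨z, rfl⟩ := hf
  induction z using TensorProduct.induction_on with
  | zero => simp
  | tmul a b => exact ⟨b ⊗ₜ a, rfl⟩
  | add x y hx hy =>
    rw [_root_.map_add, _root_.map_add]
    exact add_mem hx hy

theorem ker_map_le {f : X →ₗ[K] X'} {g : Y →ₗ[K] Y'} (hf : Function.Surjective f)
    (hg : Function.Surjective g) {L : Submodule K (TensorProduct K X Y)}
    (h₁ : ∀ a b, f a = 0 → a ⊗ₜ b ∈ L) (h₂ : ∀ a b, g b = 0 → a ⊗ₜ b ∈ L) :
    LinearMap.ker (map f g) ≤ L := by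
  rw [map_ker (LinearMap.exact_subtype_ker_map f) hf (LinearMap.exact_subtype_ker_map g) hg,
    sup_le_iff]
  constructor
  · rintro _ ⟨z, rfl⟩
    induction z using TensorProduct.induction_on with
    | zero => simp
    | tmul a b => exact h₂ a b b.2
    | add x y hx hy => rw [_root_.map_add]; exact add_mem hx hy
  · rintro _ ⟨z, rfl⟩
    induction z using TensorProduct.induction_on with
    | zero => simp
    | tmul a b => exact h₁ a b a.2
    | add x y hx hy => rw [_root_.map_add]; exact add_mem hx hy

end TensorProduct

/-! ### The global tensor functor: functoriality, sums and tensor products. -/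

namespace QuiverRep

open TensorProduct (contractEnd contractConnect)

section Morphisms

variable {K : Type u} [Field K] {V : Type v} [Quiver.{w} V] {M N : QuiverRep K V}

/-- A family of linear maps commutes with the maps of all arrows. -/
def IsHom (M N : QuiverRep K V) (f : ∀ x, M.space x →ₗ[K] N.space x) : Prop :=
  ∀ (x y : V) (a : x ⟶ y), f y ∘ₗ M.map a = N.map a ∘ₗ f x

theorem IsHom.apply {f : ∀ x, M.space x →ₗ[K] N.space x} (hf : IsHom M N f) {x y : V} (a : x ⟶ y)
    (m : M.space x) : f y (M.map a m) = N.map a (f x m) :=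
  LinearMap.congr_fun (hf x y a) m

theorem IsEpiSub.le_maxEpi {E : ∀ x, Submodule K (M.space x)} (hE : M.IsEpiSub E) (x : V) :
    E x ≤ M.maxEpi x :=
  le_iSup (fun N : {N : ∀ x, Submodule K (M.space x) // M.IsEpiSub N} => N.1 x) ⟨E, hE⟩

theorem IsMonoKer.monoKer_le {E : ∀ x, Submodule K (M.space x)} (hE : M.IsMonoKer E) (x : V) :
    M.monoKer x ≤ E x :=
  iInf_le (fun N : {N : ∀ x, Submodule K (M.space x) // M.IsMonoKer N} => N.1 x) ⟨E, hE⟩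

theorem IsEpiSub.map {f : ∀ x, M.space x →ₗ[K] N.space x} (hf : IsHom M N f)
    {E : ∀ x, Submodule K (M.space x)} (hE : M.IsEpiSub E) :
    N.IsEpiSub fun x => (E x).map (f x) := fun x y a => by
  rw [← Submodule.map_comp, ← hf, Submodule.map_comp, hE x y a]

theorem IsMonoKer.comap {f : ∀ x, M.space x →ₗ[K] N.space x} (hf : IsHom M N f)
    {E : ∀ x, Submodule K (N.space x)} (hE : N.IsMonoKer E) :
    M.IsMonoKer fun x => (E x).comap (f x) := fun x y a => by
  rw [← Submodule.comap_comp, hf, Submodule.comap_comp, hE x y a]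

theorem IsHom.mem_maxEpi {f : ∀ x, M.space x →ₗ[K] N.space x} (hf : IsHom M N f) {x : V}
    {m : M.space x} (hm : m ∈ M.maxEpi x) : f x m ∈ N.maxEpi x :=
  (M.isEpiSub_maxEpi.map hf).le_maxEpi x (Submodule.mem_map_of_mem hm)

theorem IsHom.mem_monoKer {f : ∀ x, M.space x →ₗ[K] N.space x} (hf : IsHom M N f) {x : V}
    {m : M.space x} (hm : m ∈ M.monoKer x) : f x m ∈ N.monoKer x :=
  (N.isMonoKer_monoKer.comap hf).monoKer_le x hm

/-- Two representations that are quotients of a third one by the same kernels are isomorphic. -/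
theorem isIso_of_span {Z G H : QuiverRep K V} {r : ∀ x, Z.space x →ₗ[K] G.space x}
    {s : ∀ x, Z.space x →ₗ[K] H.space x} (hr : IsHom Z G r) (hs : IsHom Z H s)
    (hr' : ∀ x, Function.Surjective (r x)) (hs' : ∀ x, Function.Surjective (s x))
    (hker : ∀ x, LinearMap.ker (r x) = LinearMap.ker (s x)) : IsIso G H := by
  let e : ∀ x, G.space x ≃ₗ[K] H.space x := fun x =>
    ((r x).quotKerEquivOfSurjective (hr' x)).symm.trans
      ((Submodule.quotEquivOfEq _ _ (hker x)).trans ((s x).quotKerEquivOfSurjective (hs' x)))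
  have he : ∀ (x : V) (z : Z.space x), e x (r x z) = s x z := fun x z => by
    have : ((r x).quotKerEquivOfSurjective (hr' x)).symm (r x z) = Submodule.Quotient.mk z := by
      rw [LinearEquiv.symm_apply_eq]
      rfl
    simp only [e, LinearEquiv.trans_apply, this]
    rfl
  refine ⟨e, fun x y a m => ?_⟩
  obtain ⟨z, rfl⟩ := hr' x m
  rw [← hr.apply, he, he, hs.apply]

variable (M) in
/-- The maximal epimorphic subrepresentation. -/
abbrev epiRep : QuiverRep K V where
  space x := M.maxEpi x
  map {x y} a := (M.map a).restrict fun m hm => by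
    rw [← M.isEpiSub_maxEpi x y a]
    exact Submodule.mem_map_of_mem hm

variable (M) in
/-- The projection of the maximal epimorphic subrepresentation onto its image in the maximal
monomorphic quotient. -/
def toGlobal (x : V) : M.epiRep.space x →ₗ[K] M.globalTensor.space x :=
  (M.monoKer x).mkQ.restrict fun _ hm => Submodule.mem_map_of_mem hm

theorem isHom_toGlobal : IsHom M.epiRep M.globalTensor M.toGlobal := fun _ _ _ => rfl

theorem toGlobal_surjective (x : V) : Function.Surjective (M.toGlobal x) := by
  rintro ⟨_, m, hm, rfl⟩
  exact ⟨⟨m, hm⟩, rfl⟩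

theorem toGlobal_eq_zero_iff {x : V} {m : M.epiRep.space x} :
    M.toGlobal x m = 0 ↔ m.1 ∈ M.monoKer x := by
  exact (Submodule.coe_eq_zero (x := (⟨(M.monoKer x).mkQ m.1, Submodule.mem_map_of_mem m.2⟩ :
    M.rankSpace x))).symm.trans (Submodule.Quotient.mk_eq_zero _)

/-- The restriction of a morphism to the maximal epimorphic subrepresentations, followed by the
projection to the image in the maximal monomorphic quotient. -/
def IsHom.epiToGlobal {f : ∀ x, M.space x →ₗ[K] N.space x} (hf : IsHom M N f) (x : V) :
    M.epiRep.space x →ₗ[K] N.globalTensor.space x :=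
  N.toGlobal x ∘ₗ (f x).restrict fun _ hm => hf.mem_maxEpi hm

theorem IsHom.isHom_epiToGlobal {f : ∀ x, M.space x →ₗ[K] N.space x} (hf : IsHom M N f) :
    IsHom M.epiRep N.globalTensor hf.epiToGlobal := fun _ y a =>
  LinearMap.ext fun m => Subtype.ext (congrArg (N.monoKer y).mkQ (hf.apply a m.1))

theorem globalTensor_congr (h : IsIso M N) : IsIso M.globalTensor N.globalTensor := by
  obtain ⟨e, he⟩ := h
  have h₁ : IsHom M N fun x => (e x).toLinearMap := fun x y a => LinearMap.ext (he x y a)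
  have h₂ : IsHom N M fun x => (e x).symm.toLinearMap := fun _ _ _ => LinearMap.ext fun n => by
    simp [LinearEquiv.symm_apply_eq, he]
  refine isIso_of_span isHom_toGlobal h₁.isHom_epiToGlobal toGlobal_surjective (fun x => ?_)
    fun x => ?_
  · refine (toGlobal_surjective x).comp ?_
    rintro ⟨n, hn⟩
    exact ⟨⟨_, h₂.mem_maxEpi hn⟩, Subtype.ext ((e x).apply_symm_apply n)⟩
  · refine Submodule.ext fun m =>
      toGlobal_eq_zero_iff.trans (Iff.trans ?_ toGlobal_eq_zero_iff.symm)
    exact ⟨fun hm => h₁.mem_monoKer hm, fun hm => by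
      simpa using h₂.mem_monoKer hm⟩

theorem globalTensor_of_bijective (h : ∀ (x y : V) (a : x ⟶ y), Function.Bijective (M.map a)) :
    IsIso M.globalTensor M := by
  have htop : ∀ x, M.maxEpi x = ⊤ := fun x => top_le_iff.1 <|
    IsEpiSub.le_maxEpi (E := fun _ => ⊤) (fun x y a => by
      rw [Submodule.map_top, LinearMap.range_eq_top]
      exact (h x y a).2) x
  have hbot : ∀ x, M.monoKer x = ⊥ := fun x => le_bot_iff.1 <|
    IsMonoKer.monoKer_le (E := fun _ => ⊥) (fun x y a => by
      rw [Submodule.comap_bot, LinearMap.ker_eq_bot]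
      exact (h x y a).1) x
  refine isIso_of_span (s := fun x => (M.maxEpi x).subtype) isHom_toGlobal (fun _ _ _ => rfl)
    toGlobal_surjective (fun x m => ⟨⟨m, htop x ▸ Submodule.mem_top⟩, rfl⟩) fun x => ?_
  refine Submodule.ext fun m => toGlobal_eq_zero_iff.trans ?_
  rw [hbot]
  rfl

theorem globalTensor_directSum (M N : QuiverRep K V) :
    IsIso (M.directSum N).globalTensor (M.globalTensor.directSum N.globalTensor) := by
  have hinl : IsHom M (M.directSum N) fun x => LinearMap.inl K (M.space x) (N.space x) :=
    fun x y a => LinearMap.ext fun m => Prod.ext rfl (map_zero (N.map a)).symm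
  have hinr : IsHom N (M.directSum N) fun x => LinearMap.inr K (M.space x) (N.space x) :=
    fun x y a => LinearMap.ext fun m => Prod.ext (map_zero (M.map a)).symm rfl
  have hfst : IsHom (M.directSum N) M fun x => LinearMap.fst K (M.space x) (N.space x) :=
    fun x y a => rfl
  have hsnd : IsHom (M.directSum N) N fun x => LinearMap.snd K (M.space x) (N.space x) :=
    fun x y a => rfl
  refine isIso_of_span (s := fun x => (hfst.epiToGlobal x).prod (hsnd.epiToGlobal x))
    isHom_toGlobal (fun x y a => ?_) toGlobal_surjective (fun x => ?_) fun x => ?_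
  · exact LinearMap.ext fun m => Prod.ext (hfst.isHom_epiToGlobal.apply a m)
      (hsnd.isHom_epiToGlobal.apply a m)
  · rintro ⟨m, n⟩
    obtain ⟨m, rfl⟩ := toGlobal_surjective x m
    obtain ⟨n, rfl⟩ := toGlobal_surjective x n
    refine ⟨⟨(m.1, n.1), ?_⟩, rfl⟩
    have := add_mem (hinl.mem_maxEpi m.2) (hinr.mem_maxEpi n.2)
    have h : LinearMap.inl K (M.space x) (N.space x) m.1 + LinearMap.inr K _ _ n.1 =
      (m.1, n.1) := by simp
    exact h ▸ this
  · refine Submodule.ext fun m => ?_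
    refine Iff.trans toGlobal_eq_zero_iff ?_
    refine Iff.trans ?_ (Prod.mk_eq_zero (x := hfst.epiToGlobal x m)
      (y := hsnd.epiToGlobal x m)).symm
    refine Iff.trans ?_ (and_congr toGlobal_eq_zero_iff toGlobal_eq_zero_iff).symm
    constructor
    · exact fun hm => ⟨hfst.mem_monoKer hm, hsnd.mem_monoKer hm⟩
    · rintro ⟨h₁, h₂⟩
      have h : LinearMap.inl K (M.space x) (N.space x) m.1.1 + LinearMap.inr K _ _ m.1.2 =
        m.1 := Prod.ext (add_zero _) (zero_add _)
      exact h ▸ add_mem (hinl.mem_monoKer h₁) (hinr.mem_monoKer h₂)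

end Morphisms

section Tensor

variable {K : Type u} [Field K] {V : Type v} [Quiver.{w} V]

/-- The pairs of a tensor in a given subrepresentation and a linear form that vanishes on another
one. -/
def TensorPair (M N : QuiverRep K V) (E F : ∀ x, Submodule K ((M.tensor N).space x)) (x : V) :
    Type u :=
  {p : TensorProduct K (M.space x) (N.space x) ×
    Module.Dual K (TensorProduct K (M.space x) (N.space x)) //
      p.1 ∈ E x ∧ F x ≤ LinearMap.ker p.2}

variable {M N : QuiverRep K V} {E F : ∀ x, Submodule K ((M.tensor N).space x)}

/-- The endomorphism defined by contracting the second factor. -/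
noncomputable def TensorPair.toEnd {x : V} (p : TensorPair M N E F x) :
    Module.End K (M.space x) :=
  contractEnd p.1.1 p.1.2

/-- The tensor is pushed forward, and the form extends along the arrow because `F` is the kernel of
a monomorphic quotient. -/
theorem TensorPair.exists_head (hE : (M.tensor N).IsEpiSub E) (hF : (M.tensor N).IsMonoKer F)
    {x y : V} (a : x ⟶ y) (p : TensorPair M N E F x) :
    ∃ (q : TensorPair M N E F y) (ψ : M.space y →ₗ[K] M.space x),
      q.toEnd = M.map a ∘ₗ ψ ∧ p.toEnd = ψ ∘ₗ M.map a := by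
  obtain ⟨⟨f, φ⟩, hf, hφ⟩ := p
  change f ∈ E x at hf
  change F x ≤ LinearMap.ker φ at hφ
  let P : Submodule K (TensorProduct K (M.space x) (N.space x)) := F x
  let Q : Submodule K (TensorProduct K (M.space y) (N.space y)) := F y
  have h : Q.comap (TensorProduct.map (M.map a) (N.map a)) = P := hF x y a
  obtain ⟨φ', hφ', rfl⟩ := Submodule.exists_dual_comp_eq h hφ
  refine ⟨⟨(TensorProduct.map (M.map a) (N.map a) f, φ'), ?_, hφ'⟩,
    contractConnect (N.map a) f φ', TensorProduct.contractEnd_map ..,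
    TensorProduct.contractEnd_comp_map ..⟩
  exact (hE x y a).le ⟨f, hf, rfl⟩

/-- Here the form is pulled back, and the tensor lifts along the arrow because `E` is epimorphic. -/
theorem TensorPair.exists_tail (hE : (M.tensor N).IsEpiSub E) (hF : (M.tensor N).IsMonoKer F)
    {x y : V} (a : x ⟶ y) (q : TensorPair M N E F y) :
    ∃ (p : TensorPair M N E F x) (ψ : M.space y →ₗ[K] M.space x),
      q.toEnd = M.map a ∘ₗ ψ ∧ p.toEnd = ψ ∘ₗ M.map a := by
  obtain ⟨⟨f, φ⟩, hf, hφ⟩ := q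
  change f ∈ E y at hf
  change F y ≤ LinearMap.ker φ at hφ
  obtain ⟨g, hg, rfl⟩ := (hE x y a).ge hf
  refine ⟨⟨(g, φ ∘ₗ TensorProduct.map (M.map a) (N.map a)), hg, ?_⟩,
    contractConnect (N.map a) g φ, TensorProduct.contractEnd_map ..,
    TensorProduct.contractEnd_comp_map ..⟩
  rw [← hF x y a]
  exact fun z hz => hφ hz

/-- Every pair at one end of an arrow has a partner at the other end, and the arrow maps the stable
range at its tail onto the one at its head. -/
theorem isEpiSub_iSup_stableRange (hE : (M.tensor N).IsEpiSub E)
    (hF : (M.tensor N).IsMonoKer F) :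
    M.IsEpiSub fun x => ⨆ p : TensorPair M N E F x, LinearMap.stableRange p.toEnd := by
  intro x y a
  rw [Submodule.map_iSup]
  apply le_antisymm
  · refine iSup_le fun p => ?_
    obtain ⟨q, ψ, hq, hp⟩ := p.exists_head hE hF a
    rw [hp, LinearMap.map_stableRange, ← hq]
    exact le_iSup (fun q : TensorPair M N E F y => LinearMap.stableRange q.toEnd) q
  · refine iSup_le fun q => ?_
    obtain ⟨p, ψ, hq, hp⟩ := q.exists_tail hE hF a
    rw [hq, ← LinearMap.map_stableRange, ← hp]
    exact le_iSup (fun p : TensorPair M N E F x => (LinearMap.stableRange p.toEnd).map (M.map a)) p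

theorem isMonoKer_iInf_stableKer (hE : (M.tensor N).IsEpiSub E)
    (hF : (M.tensor N).IsMonoKer F) :
    M.IsMonoKer fun x => ⨅ p : TensorPair M N E F x, LinearMap.stableKer p.toEnd := by
  intro x y a
  rw [Submodule.comap_iInf]
  apply le_antisymm
  · refine le_iInf fun p => ?_
    obtain ⟨q, ψ, hq, hp⟩ := p.exists_head hE hF a
    rw [hp, ← LinearMap.comap_stableKer, ← hq]
    exact iInf_le (fun q : TensorPair M N E F y => (LinearMap.stableKer q.toEnd).comap (M.map a)) q
  · refine le_iInf fun q => ?_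
    obtain ⟨p, ψ, hq, hp⟩ := q.exists_tail hE hF a
    rw [hq, LinearMap.comap_stableKer, ← hp]
    exact iInf_le (fun p : TensorPair M N E F x => LinearMap.stableKer p.toEnd) p

theorem TensorPair.stableRange_le (hE : (M.tensor N).IsEpiSub E)
    (hF : (M.tensor N).IsMonoKer F) {x : V} (p : TensorPair M N E F x) :
    LinearMap.stableRange p.toEnd ≤ M.maxEpi x :=
  (le_iSup (fun p : TensorPair M N E F x => LinearMap.stableRange p.toEnd) p).trans
    ((isEpiSub_iSup_stableRange hE hF).le_maxEpi x)

theorem TensorPair.le_stableKer (hE : (M.tensor N).IsEpiSub E)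
    (hF : (M.tensor N).IsMonoKer F) {x : V} (p : TensorPair M N E F x) :
    M.monoKer x ≤ LinearMap.stableKer p.toEnd :=
  ((isMonoKer_iInf_stableKer hE hF).monoKer_le x).trans
    (iInf_le (fun p : TensorPair M N E F x => LinearMap.stableKer p.toEnd) p)

theorem isHom_comm (M N : QuiverRep K V) : IsHom (M.tensor N) (N.tensor M)
    fun x => (TensorProduct.comm K (M.space x) (N.space x)).toLinearMap := fun _ _ _ =>
  TensorProduct.ext' fun _ _ => rfl

theorem mem_monoKer_of_forall_dual {M : QuiverRep K V} {x : V} {m : M.space x}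
    (h : ∀ φ : Module.Dual K (M.space x), M.monoKer x ≤ LinearMap.ker φ → φ m = 0) :
    m ∈ M.monoKer x := by
  by_contra hm
  obtain ⟨φ, hφ, hle⟩ := Submodule.exists_le_ker_of_notMem hm
  exact hφ (h φ hle)

/-- The contraction with any admissible `φ` has image in `M.monoKer x`, which lies in its own stable
kernel. It is thus nilpotent, its trace `φ f` is zero, and such forms detect `(M.tensor N).monoKer
x`. -/
theorem mem_monoKer_tensor_of_mem_range {x : V} {f : TensorProduct K (M.space x) (N.space x)}
    (hf : f ∈ (M.tensor N).maxEpi x) {Q : Submodule K (N.space x)}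
    (hf' : f ∈ LinearMap.range (TensorProduct.map (M.monoKer x).subtype Q.subtype)) :
    f ∈ (M.tensor N).monoKer x := by
  refine mem_monoKer_of_forall_dual fun φ hφ => ?_
  let p : TensorPair M N (M.tensor N).maxEpi (M.tensor N).monoKer x := ⟨(f, φ), hf, hφ⟩
  obtain ⟨k, hk⟩ := LinearMap.exists_pow_apply_eq_zero_of_le_stableKer
    (p.le_stableKer (M.tensor N).isEpiSub_maxEpi (M.tensor N).isMonoKer_monoKer)
  refine TensorProduct.eq_zero_of_isNilpotent_contractEnd ⟨k + 1, LinearMap.ext fun m => ?_⟩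
  rw [pow_succ, Module.End.mul_apply]
  exact hk _ (TensorProduct.contractEnd_apply_mem hf' φ m)

theorem tensorMap_mem_maxEpi {x : V} (z : TensorProduct K (M.maxEpi x) (N.maxEpi x)) :
    TensorProduct.map (M.maxEpi x).subtype (N.maxEpi x).subtype z ∈ (M.tensor N).maxEpi x := by
  refine IsEpiSub.le_maxEpi (M := M.tensor N) (E := fun x => LinearMap.range
    (TensorProduct.map (M.maxEpi x).subtype (N.maxEpi x).subtype)) (fun x y a => ?_) x ⟨z, rfl⟩
  refine (TensorProduct.map_range_map_subtype (M.map a) (N.map a) _ _).trans ?_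
  rw [M.isEpiSub_maxEpi x y a, N.isEpiSub_maxEpi x y a]
  rfl

theorem mem_monoKer_tensor_of_mem_range' {x : V} {f : TensorProduct K (M.space x) (N.space x)}
    (hf : f ∈ (M.tensor N).maxEpi x) {P : Submodule K (M.space x)}
    (hf' : f ∈ LinearMap.range (TensorProduct.map P.subtype (N.monoKer x).subtype)) :
    f ∈ (M.tensor N).monoKer x := by
  have := (isHom_comm N M).mem_monoKer (mem_monoKer_tensor_of_mem_range
    ((isHom_comm M N).mem_maxEpi hf) (TensorProduct.comm_mem_range_map_subtype hf'))
  exact (TensorProduct.comm K (M.space x) (N.space x)).symm_apply_apply f ▸ this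

/-- The maximal epimorphic subrepresentation of a tensor product is generated by the tensor product
of those of the factors, modulo the kernel of the maximal monomorphic quotient. -/
theorem exists_tensorMap_sub_mem_monoKer {x : V} {f : TensorProduct K (M.space x) (N.space x)}
    (hf : f ∈ (M.tensor N).maxEpi x) :
    ∃ z : TensorProduct K (M.maxEpi x) (N.maxEpi x),
      f - TensorProduct.map (M.maxEpi x).subtype (N.maxEpi x).subtype z ∈
        (M.tensor N).monoKer x := by
  let R : Submodule K (TensorProduct K (M.space x) (N.space x)) :=
    LinearMap.range (TensorProduct.map (M.maxEpi x).subtype (N.maxEpi x).subtype)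
  let L : Submodule K (TensorProduct K (M.space x) (N.space x)) := (M.tensor N).monoKer x
  suffices h : f ∈ R ⊔ L by
    obtain ⟨_, ⟨z, rfl⟩, l, hl, rfl⟩ := Submodule.mem_sup.1 h
    exact ⟨z, by rwa [add_sub_cancel_left]⟩
  -- Otherwise a form kills both `R` and `L` but not `f`; its contraction with `f` will turn out to
  -- be nilpotent, which is absurd.
  by_contra hf'
  obtain ⟨φ, hφ, hle⟩ := Submodule.exists_le_ker_of_notMem hf'
  refine hφ ?_
  have hL : L ≤ LinearMap.ker φ := le_sup_right.trans hle
  let p : TensorPair M N (M.tensor N).maxEpi (M.tensor N).monoKer x := ⟨(f, φ), hf, hL⟩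
  let q : TensorPair N M (N.tensor M).maxEpi (N.tensor M).monoKer x :=
    ⟨(TensorProduct.comm K _ _ f, φ ∘ₗ (TensorProduct.comm K _ _).symm.toLinearMap),
      (isHom_comm M N).mem_maxEpi hf, fun z hz => hL ((isHom_comm N M).mem_monoKer hz)⟩
  obtain ⟨k, hk⟩ := LinearMap.exists_pow_apply_mem_of_stableRange_le
    (p.stableRange_le (M.tensor N).isEpiSub_maxEpi (M.tensor N).isMonoKer_monoKer)
  obtain ⟨l, hl⟩ := LinearMap.exists_pow_apply_mem_of_stableRange_le
    (q.stableRange_le (N.tensor M).isEpiSub_maxEpi (N.tensor M).isMonoKer_monoKer)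
  -- Of the `l + k` factors, `k` stay on the left and move `m` into `M.maxEpi x`; by adjointness `l`
  -- pass to the right and move `n` into `N.maxEpi x`. The resulting tensor lies in `R`.
  have hzero : ∀ m n, φ ((contractEnd f φ ^ (l + k)) m ⊗ₜ n) = 0 := fun m n => by
    rw [pow_add, Module.End.mul_apply, TensorProduct.apply_contractEnd_pow_tmul]
    exact hle (Submodule.mem_sup_left ⟨⟨_, hk m⟩ ⊗ₜ ⟨_, hl n⟩, rfl⟩)
  refine TensorProduct.eq_zero_of_isNilpotent_contractEnd (f := f)
    ⟨l + k + 1, LinearMap.ext fun m => ?_⟩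
  rw [pow_succ', Module.End.mul_apply]
  have : TensorProduct.curry φ ((contractEnd f φ ^ (l + k)) m) = 0 := LinearMap.ext (hzero m)
  change TensorProduct.dualContract f (TensorProduct.curry φ _) = 0
  rw [this, map_zero]

/-- Over a field the tensor product of injective maps is injective, so the tensor product of the two
maximal monomorphic quotients is a monomorphic quotient of `M.tensor N`. -/
theorem monoKer_tensor_le (x : V) : (M.tensor N).monoKer x ≤
    LinearMap.ker (TensorProduct.map (M.monoKer x).mkQ (N.monoKer x).mkQ) := by
  refine IsMonoKer.monoKer_le (M := M.tensor N) (E := fun x => LinearMap.ker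
    (TensorProduct.map (M.monoKer x).mkQ (N.monoKer x).mkQ)) (fun x y a => ?_) x
  have hinj : ∀ P : QuiverRep K V, Function.Injective (P.monoMap a) := fun P => by
    rw [← LinearMap.ker_eq_bot, monoMap, Submodule.ker_mapQ, P.isMonoKer_monoKer x y a,
      Submodule.mkQ_map_self]
  have h : TensorProduct.map (M.monoKer y).mkQ (N.monoKer y).mkQ ∘ₗ
      TensorProduct.map (M.map a) (N.map a) =
      TensorProduct.map (M.monoMap a) (N.monoMap a) ∘ₗ
        TensorProduct.map (M.monoKer x).mkQ (N.monoKer x).mkQ := by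
    rw [← TensorProduct.map_comp, ← TensorProduct.map_comp]
    rfl
  change Submodule.comap (TensorProduct.map (M.map a) (N.map a)) (LinearMap.ker _) =
    LinearMap.ker _
  rw [← LinearMap.ker_comp, h, LinearMap.ker_comp_of_ker_eq_bot]
  exact LinearMap.ker_eq_bot.2
    (TensorProduct.map_injective_of_flat_flat _ _ (hinj M) (hinj N))

/-- The map from the tensor product of the maximal epimorphic subrepresentations. -/
noncomputable def tensorToGlobal (M N : QuiverRep K V) (x : V) :
    (M.epiRep.tensor N.epiRep).space x →ₗ[K] (M.tensor N).globalTensor.space x :=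
  (M.tensor N).toGlobal x ∘ₗ
    (TensorProduct.map (M.maxEpi x).subtype (N.maxEpi x).subtype).codRestrict _
      tensorMap_mem_maxEpi

theorem tensorToGlobal_eq_zero_iff {x : V} {z : TensorProduct K (M.maxEpi x) (N.maxEpi x)} :
    tensorToGlobal M N x z = 0 ↔
      TensorProduct.map (M.maxEpi x).subtype (N.maxEpi x).subtype z ∈ (M.tensor N).monoKer x :=
  toGlobal_eq_zero_iff

/-- One inclusion is generated by tensors with a factor in `monoKer`, handled by the trace argument.
The other follows from `monoKer_tensor_le` and the injectivity of the tensor product of the rank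
spaces into that of the quotients. -/
theorem ker_map_toGlobal (x : V) :
    LinearMap.ker (TensorProduct.map (M.toGlobal x) (N.toGlobal x)) =
      LinearMap.ker (tensorToGlobal M N x) := by
  refine le_antisymm ?_ fun z hz => ?_
  · refine TensorProduct.ker_map_le (toGlobal_surjective x) (toGlobal_surjective x)
      (fun a b ha => ?_) fun a b hb => ?_
    · exact tensorToGlobal_eq_zero_iff.2 <| mem_monoKer_tensor_of_mem_range
        (tensorMap_mem_maxEpi _) (Q := ⊤)
        ⟨⟨a.1, toGlobal_eq_zero_iff.1 ha⟩ ⊗ₜ ⟨b.1, Submodule.mem_top⟩, rfl⟩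
    · exact tensorToGlobal_eq_zero_iff.2 <| mem_monoKer_tensor_of_mem_range'
        (tensorMap_mem_maxEpi _) (P := ⊤)
        ⟨⟨a.1, Submodule.mem_top⟩ ⊗ₜ ⟨b.1, toGlobal_eq_zero_iff.1 hb⟩, rfl⟩
  · have h := monoKer_tensor_le x (tensorToGlobal_eq_zero_iff.1 hz)
    have h' : TensorProduct.map (M.monoKer x).mkQ (N.monoKer x).mkQ ∘ₗ
        TensorProduct.map (M.maxEpi x).subtype (N.maxEpi x).subtype =
        TensorProduct.map (M.rankSpace x).subtype (N.rankSpace x).subtype ∘ₗ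
          TensorProduct.map (M.toGlobal x) (N.toGlobal x) := by
      exact TensorProduct.ext' fun _ _ => rfl
    refine TensorProduct.map_injective_of_flat_flat (M.rankSpace x).subtype (N.rankSpace x).subtype
      (Submodule.subtype_injective _) (Submodule.subtype_injective _) ?_
    exact ((LinearMap.congr_fun h' z).symm.trans h).trans (map_zero _).symm

/-- The global tensor functor commutes with tensor products. -/
theorem globalTensor_tensor (M N : QuiverRep K V) :
    IsIso (M.tensor N).globalTensor (M.globalTensor.tensor N.globalTensor) := by
  refine isIso_of_span (r := tensorToGlobal M N)
    (s := fun x => TensorProduct.map (M.toGlobal x) (N.toGlobal x)) (fun x y a => ?_)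
    (fun x y a => TensorProduct.ext' fun _ _ => rfl) (fun x => ?_)
    (fun x => TensorProduct.map_surjective (toGlobal_surjective x) (toGlobal_surjective x))
    fun x => (ker_map_toGlobal x).symm
  · exact TensorProduct.ext' fun _ _ => rfl
  · intro g
    obtain ⟨⟨f, hf⟩, rfl⟩ := toGlobal_surjective x g
    obtain ⟨z, hz⟩ := exists_tensorMap_sub_mem_monoKer hf
    refine ⟨z, ?_⟩
    refine (sub_eq_zero.1 ((map_sub _ _ _).symm.trans (toGlobal_eq_zero_iff.2 ?_))).symm
    exact hz

theorem globalTensor_one : IsIso (one K V).globalTensor (one K V) :=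
  globalTensor_of_bijective fun _ _ _ => Function.bijective_id

end Tensor

end QuiverRep

/-! ### From the crossing paths quiver to the loop. -/

namespace QuiverRep

variable {K : Type u} [Field K]

section Pullback

theorem crossPullback_congr {M N : QuiverRep K CrossVertex} (h : IsIso M N) :
    IsIso M.crossPullback N.crossPullback := by
  obtain ⟨e, he⟩ := h
  refine ⟨fun x => e (squareToCross x), ?_⟩
  have key : ∀ {x y z : CrossVertex} (f : x ⟶ y) (g : y ⟶ z) (m : M.space x),
      e z ((M.map g ∘ₗ M.map f) m) = (N.map g ∘ₗ N.map f) (e x m) := fun f g m => by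
    rw [LinearMap.comp_apply, LinearMap.comp_apply, he, he]
  rintro _ _ (_ | _ | _ | _) m <;> exact key _ _ m

theorem crossPullback_directSum (M N : QuiverRep K CrossVertex) :
    IsIso (M.directSum N).crossPullback (M.crossPullback.directSum N.crossPullback) := by
  refine ⟨fun x => LinearEquiv.refl K _, ?_⟩
  rintro _ _ (_ | _ | _ | _) m <;> rfl

theorem crossPullback_tensor (M N : QuiverRep K CrossVertex) :
    IsIso (M.tensor N).crossPullback (M.crossPullback.tensor N.crossPullback) := by
  refine ⟨fun x => LinearEquiv.refl K _, ?_⟩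
  rintro _ _ (_ | _ | _ | _) m <;>
    exact (LinearMap.congr_fun (TensorProduct.map_comp _ _ _ _) m).symm

theorem crossPullback_one : IsIso (one K CrossVertex).crossPullback (one K SquareVertex) := by
  refine ⟨fun x => LinearEquiv.refl K _, ?_⟩
  rintro _ _ (_ | _ | _ | _) m <;> rfl

end Pullback

section Loop

/-- All maps of a representation are bijective. -/
def IsBijective {V : Type v} [Quiver.{w} V] (M : QuiverRep K V) : Prop :=
  ∀ (x y : V) (a : x ⟶ y), Function.Bijective (M.map a)

variable {M N : QuiverRep K SquareVertex}

/-- The vector `p` at `w4` certifies the value of the monodromy without inverse maps; compatibility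
with isomorphisms, sums and tensors is then checked on such certificates. -/
theorem loopFunctor_map_eq (h : M.IsBijective) {m n : M.space .w1} (p : M.space .w4)
    (h₁ : M.map SquareVertex.Arrow.a12 m = M.map SquareVertex.Arrow.a42 p)
    (h₂ : M.map SquareVertex.Arrow.a45 p = M.map SquareVertex.Arrow.a15 n) :
    (loopFunctor M h).map LoopVertex.loop m = n := by
  have hp : (M.arrowEquiv h SquareVertex.Arrow.a42).symm
      (M.arrowEquiv h SquareVertex.Arrow.a12 m) = p :=
    (LinearEquiv.symm_apply_eq _).2 h₁
  have hn : (M.arrowEquiv h SquareVertex.Arrow.a15).symm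
      (M.arrowEquiv h SquareVertex.Arrow.a45 p) = n :=
    (LinearEquiv.symm_apply_eq _).2 h₂
  exact (congrArg (fun q => (M.arrowEquiv h SquareVertex.Arrow.a15).symm
    (M.arrowEquiv h SquareVertex.Arrow.a45 q)) hp).trans hn

theorem exists_loopFunctor_map (h : M.IsBijective) (m : M.space .w1) :
    ∃ p : M.space .w4, M.map SquareVertex.Arrow.a12 m = M.map SquareVertex.Arrow.a42 p ∧
      M.map SquareVertex.Arrow.a45 p =
        M.map SquareVertex.Arrow.a15 ((loopFunctor M h).map LoopVertex.loop m) := by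
  obtain ⟨p, hp⟩ := (h _ _ SquareVertex.Arrow.a42).2 (M.map SquareVertex.Arrow.a12 m)
  obtain ⟨n, hn⟩ := (h _ _ SquareVertex.Arrow.a15).2 (M.map SquareVertex.Arrow.a45 p)
  refine ⟨p, hp.symm, ?_⟩
  rw [loopFunctor_map_eq h p hp.symm hn.symm, hn]

theorem isIso_loop {P Q : QuiverRep K LoopVertex} (e : P.space .pt ≃ₗ[K] Q.space .pt)
    (he : ∀ m, e (P.map LoopVertex.loop m) = Q.map LoopVertex.loop (e m)) : IsIso P Q :=
  ⟨fun | .pt => e, fun | .pt, .pt, _, m => he m⟩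

theorem loopFunctor_congr (hM : M.IsBijective) (hN : N.IsBijective) (h : IsIso M N) :
    IsIso (loopFunctor M hM) (loopFunctor N hN) := by
  obtain ⟨e, he⟩ := h
  refine isIso_loop (e .w1) fun m => ?_
  obtain ⟨p, h₁, h₂⟩ := exists_loopFunctor_map hM m
  exact (loopFunctor_map_eq hN (e .w4 p)
    ((he _ _ _ m).symm.trans ((congrArg (e .w2) h₁).trans (he _ _ _ p)))
    ((he _ _ _ p).symm.trans ((congrArg (e .w5) h₂).trans (he _ _ _ _)))).symm

theorem IsBijective.directSum (hM : M.IsBijective) (hN : N.IsBijective) :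
    (M.directSum N).IsBijective := fun _ _ a => (hM _ _ a).prodMap (hN _ _ a)

theorem IsBijective.tensor (hM : M.IsBijective) (hN : N.IsBijective) :
    (M.tensor N).IsBijective := fun _ _ a =>
  (TensorProduct.congr (M.arrowEquiv hM a) (N.arrowEquiv hN a)).bijective

theorem loopFunctor_directSum (hM : M.IsBijective) (hN : N.IsBijective) :
    IsIso (loopFunctor (M.directSum N) (hM.directSum hN))
      ((loopFunctor M hM).directSum (loopFunctor N hN)) := by
  refine isIso_loop (LinearEquiv.refl K _) fun m => ?_
  obtain ⟨p, h₁, h₂⟩ := exists_loopFunctor_map hM m.1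
  obtain ⟨q, h₃, h₄⟩ := exists_loopFunctor_map hN m.2
  exact loopFunctor_map_eq (M := M.directSum N) (hM.directSum hN) (p, q) (Prod.ext h₁ h₃)
    (Prod.ext h₂ h₄)

theorem loopFunctor_tensor (hM : M.IsBijective) (hN : N.IsBijective) :
    IsIso (loopFunctor (M.tensor N) (hM.tensor hN))
      ((loopFunctor M hM).tensor (loopFunctor N hN)) := by
  refine isIso_loop (LinearEquiv.refl K _) fun m => ?_
  let f : TensorProduct K (M.space .w1) (N.space .w1) →ₗ[K]
      TensorProduct K (M.space .w1) (N.space .w1) :=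
    (loopFunctor (M.tensor N) (hM.tensor hN)).map LoopVertex.loop
  let g : TensorProduct K (M.space .w1) (N.space .w1) →ₗ[K]
      TensorProduct K (M.space .w1) (N.space .w1) :=
    TensorProduct.map ((loopFunctor M hM).map LoopVertex.loop)
      ((loopFunctor N hN).map LoopVertex.loop)
  have h : f = g := TensorProduct.ext' fun m n => by
    obtain ⟨p, h₁, h₂⟩ := exists_loopFunctor_map hM m
    obtain ⟨q, h₃, h₄⟩ := exists_loopFunctor_map hN n
    exact loopFunctor_map_eq (M := M.tensor N) (hM.tensor hN) (p ⊗ₜ q)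
      (congrArg₂ (fun a b => a ⊗ₜ b) h₁ h₃) (congrArg₂ (fun a b => a ⊗ₜ b) h₂ h₄)
  exact LinearMap.congr_fun h m

theorem isBijective_one {V : Type v} [Quiver.{w} V] : (one K V).IsBijective :=
  fun _ _ _ => Function.bijective_id

theorem loopFunctor_one :
    IsIso (loopFunctor (one K SquareVertex) isBijective_one) (one K LoopVertex) :=
  isIso_loop (LinearEquiv.refl K _) fun m =>
    loopFunctor_map_eq (M := one K SquareVertex) (m := m) (n := m) isBijective_one m rfl rfl

end Loop

section CrossToLoop

theorem isBijective_globalTensor {V : Type v} [Quiver.{w} V] (M : QuiverRep K V) :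
    M.globalTensor.IsBijective := fun _ _ a => M.globalTensor_bijective a

theorem crossToLoop_congr {M N : QuiverRep K CrossVertex} (h : IsIso M N) :
    IsIso M.crossToLoop N.crossToLoop :=
  loopFunctor_congr _ _ (globalTensor_congr (crossPullback_congr h))

theorem crossToLoop_directSum (M N : QuiverRep K CrossVertex) :
    IsIso (M.directSum N).crossToLoop (M.crossToLoop.directSum N.crossToLoop) :=
  (loopFunctor_congr _ ((isBijective_globalTensor _).directSum (isBijective_globalTensor _))
    ((globalTensor_congr (crossPullback_directSum M N)).trans (globalTensor_directSum _ _))).trans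
    (loopFunctor_directSum _ _)

theorem crossToLoop_tensor (M N : QuiverRep K CrossVertex) :
    IsIso (M.tensor N).crossToLoop (M.crossToLoop.tensor N.crossToLoop) :=
  (loopFunctor_congr _ ((isBijective_globalTensor _).tensor (isBijective_globalTensor _))
    ((globalTensor_congr (crossPullback_tensor M N)).trans (globalTensor_tensor _ _))).trans
    (loopFunctor_tensor _ _)

theorem crossToLoop_one : IsIso (one K CrossVertex).crossToLoop (one K LoopVertex) :=
  (loopFunctor_congr _ isBijective_one
    ((globalTensor_congr crossPullback_one).trans globalTensor_one)).trans loopFunctor_one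

/-- The homomorphism of representation rings induced by the passage from the crossing paths quiver
to the loop quiver. -/
noncomputable def crossToLoopHom (K : Type u) [Field K] :
    RepRing K CrossVertex →+* RepRing K LoopVertex :=
  RepRing.lift (fun M => M.crossToLoop.cls) (fun _ _ h => cls_eq_of_isIso (crossToLoop_congr h))
    (fun M N => by rw [cls_eq_of_isIso (crossToLoop_directSum M N), cls_directSum])
    (by rw [cls_eq_of_isIso crossToLoop_one, cls_one])
    (fun M N => by rw [cls_eq_of_isIso (crossToLoop_tensor M N), cls_tensor])

theorem crossToLoopHom_cls (M : QuiverRep K CrossVertex) :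
    crossToLoopHom K M.cls = M.crossToLoop.cls :=
  RepRing.lift_cls ..

/-- The spaces of the representation of the crossing paths quiver with prescribed monodromy. -/
def crossSpace (U : Type u) : CrossVertex → Type u
  | .v1 | .v2 | .v4 | .v5 => U
  | .v3 => U × U

/-- A representation of the crossing paths quiver with prescribed monodromy. -/
def crossOfEnd (U : Type u) [AddCommGroup U] [Module K U] [FiniteDimensional K U]
    (A : U →ₗ[K] U) : QuiverRep K CrossVertex where
  space := crossSpace U
  addCommGroup
    | .v1 | .v2 | .v4 | .v5 => inferInstanceAs (AddCommGroup U)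
    | .v3 => inferInstanceAs (AddCommGroup (U × U))
  module
    | .v1 | .v2 | .v4 | .v5 => inferInstanceAs (Module K U)
    | .v3 => inferInstanceAs (Module K (U × U))
  finite
    | .v1 | .v2 | .v4 | .v5 => inferInstanceAs (FiniteDimensional K U)
    | .v3 => inferInstanceAs (FiniteDimensional K (U × U))
  map
    | .a => LinearMap.inl K U U
    | .b => LinearMap.inr K U U
    | .c => (LinearMap.coprod LinearMap.id LinearMap.id : U × U →ₗ[K] U)
    | .d => (LinearMap.coprod LinearMap.id A : U × U →ₗ[K] U)

/-- With `U × U` at the centre, the four paths of `crossOfEnd` are the identity three times and `A`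
from `v4` to `v5`. All are bijective, so the global tensor functor changes nothing, and going round
the square gives `A`. -/
theorem cls_mem_range_crossToLoopHom (N : QuiverRep K LoopVertex)
    (h : Function.Bijective (N.map LoopVertex.loop)) : N.cls ∈ (crossToLoopHom K).range := by
  let U := N.space .pt
  let A : U →ₗ[K] U := N.map LoopVertex.loop
  let M := crossOfEnd U A
  have h12 : ∀ m : U, M.crossPullback.map SquareVertex.Arrow.a12 m = m := fun m => add_zero m
  have h15 : ∀ m : U, M.crossPullback.map SquareVertex.Arrow.a15 m = m := fun m =>
    (congrArg (m + ·) (map_zero A)).trans (add_zero m)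
  have h42 : ∀ m : U, M.crossPullback.map SquareVertex.Arrow.a42 m = m := fun m => zero_add m
  have h45 : ∀ m : U, M.crossPullback.map SquareVertex.Arrow.a45 m = A m := fun m => zero_add (A m)
  have hM : M.crossPullback.IsBijective := by
    rintro _ _ (_ | _ | _ | _)
    · exact (funext h12 : _ = id) ▸ Function.bijective_id
    · exact (funext h15 : _ = id) ▸ Function.bijective_id
    · exact (funext h42 : _ = id) ▸ Function.bijective_id
    · exact (funext h45 : _ = (A : U → U)) ▸ h
  refine ⟨M.cls, ?_⟩
  rw [crossToLoopHom_cls]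
  refine cls_eq_of_isIso ((loopFunctor_congr _ hM (globalTensor_of_bijective hM)).trans
    (isIso_loop (LinearEquiv.refl K U) fun m => ?_))
  exact loopFunctor_map_eq (M := M.crossPullback) (m := m) (n := A m) hM m
    ((h12 m).trans (h42 m).symm) ((h45 m).trans (h15 (A m)).symm)

end CrossToLoop

end QuiverRep

/-! ### The crossing paths quiver as a star, and the main theorem. -/

theorem isTreeQuiver_crossVertex : IsTreeQuiver CrossVertex := by
  have hgraph : QuiverGraph CrossVertex = SimpleGraph.starGraph CrossVertex.v3 := by
    ext x y
    rw [QuiverGraph, SimpleGraph.fromRel_adj, SimpleGraph.starGraph_adj]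
    refine and_congr_right fun _ => ⟨?_, ?_⟩
    · have key : ∀ {x y : CrossVertex}, CrossVertex.Arrow x y → x = .v3 ∨ y = .v3 := by
        rintro _ _ (_ | _ | _ | _) <;> simp
      rintro (⟨⟨f⟩⟩ | ⟨⟨f⟩⟩)
      · exact key f
      · exact (key f).symm
    · rintro (rfl | rfl)
      · cases y
        · exact .inr ⟨.a⟩
        · exact .inl ⟨.c⟩
        · contradiction
        · exact .inr ⟨.b⟩
        · exact .inl ⟨.d⟩
      · cases x
        · exact .inl ⟨.a⟩
        · exact .inr ⟨.c⟩
        · contradiction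
        · exact .inl ⟨.b⟩
        · exact .inr ⟨.d⟩
  refine ⟨?_, ?_, ?_, ?_⟩
  · rw [IsConnectedQuiver, hgraph]
    exact SimpleGraph.connected_starGraph _
  · exact fun x => ⟨fun f => by change CrossVertex.Arrow x x at f; cases f⟩
  · refine fun x y => ⟨?_⟩
    rintro (f | f) (g | g) <;> change CrossVertex.Arrow _ _ at f <;>
      change CrossVertex.Arrow _ _ at g <;> cases f <;> cases g <;> rfl
  · rw [hgraph]
    exact SimpleGraph.isAcyclic_starGraph _

theorem mainTheorem11 (K : Type u) [Field K] :
    ¬ QuiverRep.FiniteMultiplicativeType K LoopVertex ∧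
    IsTreeQuiver CrossVertex ∧
    ¬ QuiverRep.FiniteMultiplicativeType K CrossVertex ∧
    (∃ φ : QuiverRep.RepRing K CrossVertex →+* QuiverRep.RepRing K LoopVertex,
      (∀ M : QuiverRep K CrossVertex, φ M.cls = M.crossToLoop.cls) ∧
      ∀ N : QuiverRep K LoopVertex, Function.Bijective (N.map LoopVertex.loop) →
        N.cls ∈ φ.range) ∧
    ∀ (V : Type v) [Quiver.{w} V] [Finite V] [∀ x y : V, Finite (x ⟶ y)],
      QuiverRep.FiniteMultiplicativeType K V →
        IsForestQuiver V ∧ (IsConnectedQuiver V → IsTreeQuiver V) := by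
  refine ⟨QuiverRep.not_finiteMultiplicativeType_of_joinedAvoiding LoopVertex.loop (.refl _),
    isTreeQuiver_crossVertex,
    QuiverRep.not_finite_of_cyclicRep_mem_range (QuiverRep.crossToLoopHom K) LoopVertex.loop
      (.refl _) fun n => QuiverRep.cls_mem_range_crossToLoopHom _ ?_,
    ⟨QuiverRep.crossToLoopHom K, QuiverRep.crossToLoopHom_cls,
      QuiverRep.cls_mem_range_crossToLoopHom⟩, fun V _ _ _ hV => ?_⟩
  -- The cyclic shift is invertible, so all cyclic representations of the loop lie in the image of
  -- `crossToLoopHom`.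
  · exact (LinearEquiv.funCongrLeft K K (Equiv.addRight _)).bijective
  · have h : IsForestQuiver V := isForestQuiver_of_not_joinedAvoiding fun x y a h =>
      QuiverRep.not_finiteMultiplicativeType_of_joinedAvoiding a h hV
    exact ⟨h, fun hc => ⟨hc, h⟩⟩
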